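/- A digraph $G=(V,E)$ is finite; an arc $(u,v)\in E$ means that $u$ attacks $v$. A set $S\subseteq V$ is admissible if no arc has both endpoints in $S$ and, for every $v\in S$ and every arc $(u,v)\in E$, there is an arc $(w,u)\in E$ with $w\in S$. A preferred extension is an inclusion-wise maximal admissible set. A $2$-cycle consists of two distinct vertices $u,v$ with $(u,v),(v,u)\in E$. For a digraph $G$ on $n$ vertices let $r=r_G\in[0,1]$ be the fraction of its vertices that lie on at least one $2$-cycle ($r=0$ if $n=0$), and put $$\beta_G=\Bigl(1+2^{1/4}-\tfrac1{\sqrt2}\Bigr)^{r}\Bigl(2-\tfrac1{\sqrt2}\Bigr)^{1-r}.$$ Theorem. There is an algorithm that, given a digraph $G$ (as its adjacency matrix), outputs a list without repetitions of admissible sets of $G$ that contains all preferred extensions of $G$ (and possibly also some admissible sets that are not maximal). Its running time is $O^*\bigl(\beta_G^{\,n+o(n)}\bigr)$, and also $O^*\bigl((1.4822^{r}\,1.2929^{1-r})^{n}\bigr)$; that is, there are a polynomial $p$ and a function $f$ with $f(n)=o(n)$, both independent of $G$, such that the number of steps on every digraph $G$ on $n$ vertices is at most $p(n)\,\beta_G^{\,n+f(n)}$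 and at most $p(n)\,(1.4822^{r}\,1.2929^{1-r})^{n}$. Here an algorithm is a single program, independent of $G$, for a machine on binary trees with unit cost for passing a pointer on, forming a pair, taking a component of a pair, and testing for emptiness. Furthermore, $G$ has at most $O^*\bigl(\beta_G^{\,n}\bigr)$ preferred extensions, and hence $O^*\bigl((1.4822^{r}\,1.2929^{1-r})^{n}\bigr)$: there is a polynomial $q$ such that every digraph $G$ on $n$ vertices has at most $q(n)\,\beta_G^{\,n}$ and at most $q(n)\,(1.4822^{r}\,1.2929^{1-r})^{n}$ preferred extensions. -/

import Mathlib

/-! ### Argumentation frameworks -/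

namespace AF

variable {V : Type*}

/-- `S` is conflict-free: no arc of `G` has both endpoints in `S`. -/
def ConflictFree (G : Digraph V) (S : Finset V) : Prop :=
  ∀ u ∈ S, ∀ v ∈ S, ¬ G.Adj u v

/-- `v` is acceptable with respect to `S`: every attacker of `v` is attacked by a member of `S`. -/
def Acceptable (G : Digraph V) (S : Finset V) (v : V) : Prop :=
  ∀ u, G.Adj u v → ∃ w ∈ S, G.Adj w u

/-- `S` is admissible: it is conflict-free and each of its members is acceptable
with respect to it. -/
def Admissible (G : Digraph V) (S : Finset V) : Prop :=
  ConflictFree G S ∧ ∀ v ∈ S, Acceptable G S v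

/-- A preferred extension is an inclusion-wise maximal admissible set. -/
def Preferred (G : Digraph V) (S : Finset V) : Prop :=
  Maximal (Admissible G) S

/-- `v` lies on a 2-cycle of `G` (a loop is not a 2-cycle). -/
def OnTwoCycle (G : Digraph V) (v : V) : Prop :=
  ∃ w, w ≠ v ∧ G.Adj v w ∧ G.Adj w v

/-- The proportion of the vertices of `G` that lie on at least one 2-cycle
(with value `0` for the digraph without vertices). -/
noncomputable def twoCycleFraction [Fintype V] (G : Digraph V) : ℝ :=
  ({v | OnTwoCycle G v}.ncard : ℝ) / (Fintype.card V : ℝ)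

end AF

/-! ### A machine model with a step count

Programs that work on binary trees, in the style of Jones's WHILE language. A tree is a pointer
to a pair of trees or the empty pointer, and each elementary step (passing a pointer on, forming a
pair, taking a component of a pair, testing for emptiness, entering a construct) has cost one. There
is no primitive that compares or traverses whole trees. -/

namespace TreeMachine

/-- Data of the machine: binary trees. -/
inductive Data : Type
  | nil : Data
  | node : Data → Data → Data

/-- Programs, read as (partial) maps from trees to trees. -/
inductive Prog : Type
  | skip : Prog
  | nil : Prog
  | left : Prog
  | right : Prog
  | pair : Prog → Prog → Prog
  | seq : Prog → Prog → Prog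
  | ite : Prog → Prog → Prog → Prog
  | loop : Prog → Prog → Prog

/-- `Runs P x y t`: on input `x` the program `P` halts with output `y` after exactly `t` elementary
steps. A tree counts as `true` in a test when it is not `nil`; `loop c f` repeatedly replaces the
current tree by its image under `f` as long as the test `c` succeeds on it. -/
inductive Runs : Prog → Data → Data → ℕ → Prop
  | skip (x : Data) : Runs .skip x x 1
  | nil (x : Data) : Runs .nil x .nil 1
  | left_nil : Runs .left .nil .nil 1
  | left_node (a b : Data) : Runs .left (.node a b) a 1
  | right_nil : Runs .right .nil .nil 1
  | right_node (a b : Data) : Runs .right (.node a b) b 1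
  | pair {f g : Prog} {x y z : Data} {s t : ℕ} :
      Runs f x y s → Runs g x z t → Runs (.pair f g) x (.node y z) (s + t + 1)
  | seq {f g : Prog} {x y z : Data} {s t : ℕ} :
      Runs f x y s → Runs g y z t → Runs (.seq f g) x z (s + t + 1)
  | ite_true {c f g : Prog} {x a b y : Data} {s t : ℕ} :
      Runs c x (.node a b) s → Runs f x y t → Runs (.ite c f g) x y (s + t + 1)
  | ite_false {c f g : Prog} {x y : Data} {s t : ℕ} :
      Runs c x .nil s → Runs g x y t → Runs (.ite c f g) x y (s + t + 1)
  | loop_done {c f : Prog} {x : Data} {s : ℕ} :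
      Runs c x .nil s → Runs (.loop c f) x x (s + 1)
  | loop_step {c f : Prog} {x a b y z : Data} {s t u : ℕ} :
      Runs c x (.node a b) s → Runs f x y t → Runs (.loop c f) y z u →
        Runs (.loop c f) x z (s + t + u + 1)

/-- A truth value as a tree: `nil` is false, the pair of two empty trees is true. -/
noncomputable def encodeProp (p : Prop) : Data :=
  open Classical in if p then .node .nil .nil else .nil

/-- A list of trees as a tree: `nil` is the empty list, `node a l` is `a` followed by `l`. -/
def encodeList : List Data → Data
  | [] => .nil
  | a :: l => .node a (encodeList l)

/-- A set of vertices as the list of the `n` bits of its characteristic vector. -/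
noncomputable def encodeSet {n : ℕ} (S : Finset (Fin n)) : Data :=
  encodeList ((List.finRange n).map fun i => encodeProp (i ∈ S))

/-- A list of sets of vertices as the list of their characteristic vectors. -/
noncomputable def encodeSets {n : ℕ} (L : List (Finset (Fin n))) : Data :=
  encodeList (L.map encodeSet)

/-- A digraph on the vertices `0, …, n - 1` as its adjacency matrix, a list of `n` rows of `n` bits;
entry `(i, j)` tells whether there is an arc from `i` to `j`. -/
noncomputable def encodeDigraph {n : ℕ} (G : Digraph (Fin n)) : Data :=
  encodeList ((List.finRange n).map fun i =>
    encodeList ((List.finRange n).map fun j => encodeProp (G.Adj i j)))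

end TreeMachine

/-! ### The bound -/

/-- The base `(1 + 2^{1/4} - 2^{-1/2})^r (2 - 2^{-1/2})^{1-r}`. -/
noncomputable def mlsBase (r : ℝ) : ℝ :=
  (1 + (2 : ℝ) ^ (1 / 4 : ℝ) - 1 / √2) ^ r * (2 - 1 / √2) ^ (1 - r)

/-- The rounded base `1.4822^r 1.2929^{1-r}`. -/
noncomputable def mlsBaseRounded (r : ℝ) : ℝ :=
  (1.4822 : ℝ) ^ r * (1.2929 : ℝ) ^ (1 - r)

/-! Branch on whether a vertex `v` belongs to the extension. The search keeps a set `M` of vertices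
still allowed and a set `I` of vertices already chosen. Deleting undefended vertices from `M` loses
no admissible subset (`Admissible.subset_prune`). Putting `v` in removes its conflict neighbours and
leaves `v` isolated; leaving `v` out removes `v`, and further pruning may follow. When no conflict
remains, the pruned set is itself admissible, so it is the only possible preferred extension inside
`M`.

The tree is measured by a product of vertex weights: 1 for isolated vertices, 323/250 for those in
conflict but on no 2-cycle inside `M`, and 37/25 for those on one. These lie just below 2 - 1/√2 ≈
1.29289 and 1 + 2^(1/4) - 1/√2 ≈ 1.4821, so a bound by the weight gives both claimed bases, even
without the o(n) term. `IsPivot.potential_add_le` shows that the potentials of the two branches add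
up to at most that of the parent.

The hard case has no 2-cycle and every non-isolated vertex with exactly two attackers and two
targets; there a branching with plain weights costs too much. Leaving `v` out then either makes at
least two further vertices disappear or become isolated, or leaves a vertex with one attacker and a
target, where the next branching is better than needed. The factor `penalty` moves this surplus back
one step. It must satisfy 2c ≤ 1.292^3 and c/1.292^5 + 1/1.292 ≤ c, so c lies between about 1.0717
and 1.0783; the value used is 43/40.

By induction the list length is at most the potential and the number of search steps at most (|M| +
1) times the potential (`search_correct`). A small calculus of uniform polynomial-time programs
(`PolyRuns`) then implements one search step in time polynomial in n alone, whatever the length of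
the stack. -/

namespace AF

/-! ### Pruning to the largest defended subset -/

section Pruning

variable {V : Type*}

open Classical in
/-- One round of deleting the members of `M` that `M` does not defend. -/
noncomputable def pruneStep (G : Digraph V) (M : Finset V) : Finset V :=
  {v ∈ M | Acceptable G M v}

theorem mem_pruneStep {G : Digraph V} {M : Finset V} {v : V} :
    v ∈ pruneStep G M ↔ v ∈ M ∧ Acceptable G M v := by
  simp [pruneStep]

theorem pruneStep_subset (G : Digraph V) (M : Finset V) : pruneStep G M ⊆ M :=
  fun _ h => (mem_pruneStep.1 h).1

/-- Delete undefended members until every remaining member is defended. -/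
noncomputable def prune [Fintype V] (G : Digraph V) (M : Finset V) : Finset V :=
  (pruneStep G)^[Fintype.card V] M

theorem iterate_pruneStep_subset (G : Digraph V) (M : Finset V) (k : ℕ) :
    (pruneStep G)^[k] M ⊆ M := by
  induction k with
  | zero => simp
  | succ k ih =>
    rw [Function.iterate_succ_apply']
    exact (pruneStep_subset G _).trans ih

theorem prune_subset [Fintype V] (G : Digraph V) (M : Finset V) : prune G M ⊆ M :=
  iterate_pruneStep_subset G M _

theorem Acceptable.mono {G : Digraph V} {S T : Finset V} (h : S ⊆ T) {v : V}
    (hv : Acceptable G S v) : Acceptable G T v := fun u hu =>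
  let ⟨w, hw, hwu⟩ := hv u hu
  ⟨w, h hw, hwu⟩

/-- The members of `S` are defended by `S` itself, hence by any superset, so no round of deletion
can touch them. -/
theorem Admissible.subset_prune [Fintype V] {G : Digraph V} {S M : Finset V}
    (hS : Admissible G S) (h : S ⊆ M) : S ⊆ prune G M := by
  unfold prune
  generalize Fintype.card V = k
  induction k with
  | zero => simpa using h
  | succ k ih =>
    rw [Function.iterate_succ_apply']
    exact fun v hv => mem_pruneStep.2 ⟨ih hv, (hS.2 v hv).mono ih⟩

theorem pruneStep_prune [Fintype V] (G : Digraph V) (M : Finset V) :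
    pruneStep G (prune G M) = prune G M := by
  -- A round that changes the set loses a vertex, so either the process is already stationary or `k`
  -- vertices are gone; at `k = Fintype.card V` the latter leaves the empty set, which is stationary
  -- too.
  have key : ∀ k, pruneStep G ((pruneStep G)^[k] M) = (pruneStep G)^[k] M ∨
      ((pruneStep G)^[k] M).card + k ≤ Fintype.card V := by
    intro k
    induction k with
    | zero => exact Or.inr (by simpa using Finset.card_le_univ M)
    | succ k ih =>
      rw [Function.iterate_succ_apply']
      rcases ih with ih | ih
      · left; rw [ih, ih]
      · by_cases h : pruneStep G ((pruneStep G)^[k] M) = (pruneStep G)^[k] M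
        · left; rw [h, h]
        · right
          have := Finset.card_lt_card
            ((pruneStep_subset G ((pruneStep G)^[k] M)).ssubset_of_ne h)
          omega
  rcases key (Fintype.card V) with h | h
  · exact h
  · have h0 : (pruneStep G)^[Fintype.card V] M = ∅ := by
      rw [← Finset.card_eq_zero]; omega
    unfold prune
    rw [h0, ← Finset.subset_empty]
    exact pruneStep_subset G ∅

/-- Every member of `M` is defended by `M`. -/
def Defended (G : Digraph V) (M : Finset V) : Prop :=
  ∀ v ∈ M, Acceptable G M v

theorem defended_prune [Fintype V] (G : Digraph V) (M : Finset V) : Defended G (prune G M) :=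
  fun _ hv => (mem_pruneStep.1 ((pruneStep_prune G M).symm ▸ hv)).2

end Pruning

/-! ### Weights, potential and branching rules -/

section Weights

variable {V : Type*}

open Classical in
/-- The members of `M` in conflict with `v`. -/
noncomputable def nbrs (G : Digraph V) (M : Finset V) (v : V) : Finset V :=
  {w ∈ M | G.Adj v w ∨ G.Adj w v}

open Classical in
/-- The members of `M` on a 2-cycle with `v`. -/
noncomputable def partners (G : Digraph V) (M : Finset V) (v : V) : Finset V :=
  {w ∈ M | G.Adj v w ∧ G.Adj w v}

open Classical in
/-- The members of `M` attacking `v`. -/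
noncomputable def attackers (G : Digraph V) (M : Finset V) (v : V) : Finset V :=
  {w ∈ M | G.Adj w v}

open Classical in
/-- The members of `M` attacked by `v`. -/
noncomputable def targets (G : Digraph V) (M : Finset V) (v : V) : Finset V :=
  {w ∈ M | G.Adj v w}

variable {G : Digraph V} {M N : Finset V} {u v : V}

theorem mem_nbrs : u ∈ nbrs G M v ↔ u ∈ M ∧ (G.Adj v u ∨ G.Adj u v) := by simp [nbrs]

theorem mem_partners : u ∈ partners G M v ↔ u ∈ M ∧ G.Adj v u ∧ G.Adj u v := by simp [partners]

theorem mem_attackers : u ∈ attackers G M v ↔ u ∈ M ∧ G.Adj u v := by simp [attackers]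

theorem mem_targets : u ∈ targets G M v ↔ u ∈ M ∧ G.Adj v u := by simp [targets]

theorem partners_subset_nbrs : partners G M v ⊆ nbrs G M v := fun _ h =>
  mem_nbrs.2 ⟨(mem_partners.1 h).1, Or.inl (mem_partners.1 h).2.1⟩

theorem nbrs_mono (h : N ⊆ M) : nbrs G N v ⊆ nbrs G M v := fun _ hu =>
  mem_nbrs.2 ⟨h (mem_nbrs.1 hu).1, (mem_nbrs.1 hu).2⟩

theorem partners_mono (h : N ⊆ M) : partners G N v ⊆ partners G M v := fun _ hu =>
  mem_partners.2 ⟨h (mem_partners.1 hu).1, (mem_partners.1 hu).2⟩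

open Classical in
/-- The weight of a vertex inside `M`. -/
noncomputable def vertexWeight (G : Digraph V) (M : Finset V) (v : V) : ℝ :=
  if nbrs G M v = ∅ then 1 else if partners G M v = ∅ then 323 / 250 else 37 / 25

/-- The weight of `M`. -/
noncomputable def weight (G : Digraph V) (M : Finset V) : ℝ :=
  ∏ v ∈ M, vertexWeight G M v

theorem one_le_vertexWeight : 1 ≤ vertexWeight G M v := by
  unfold vertexWeight; split_ifs <;> norm_num

theorem one_le_weight : 1 ≤ weight G M :=
  Finset.prod_induction _ (1 ≤ ·) (fun _ _ => one_le_mul_of_one_le_of_one_le) le_rfl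
    fun _ _ => one_le_vertexWeight

theorem le_vertexWeight (h : (nbrs G M v).Nonempty) : 323 / 250 ≤ vertexWeight G M v := by
  unfold vertexWeight
  rw [if_neg h.ne_empty]; split_ifs <;> norm_num

theorem vertexWeight_of_partners (h : (partners G M v).Nonempty) :
    vertexWeight G M v = 37 / 25 := by
  unfold vertexWeight
  rw [if_neg (h.mono partners_subset_nbrs).ne_empty, if_neg h.ne_empty]

theorem vertexWeight_le_of_partners (h : partners G M v = ∅) :
    vertexWeight G M v ≤ 323 / 250 := by
  unfold vertexWeight
  rw [if_pos h]; split_ifs <;> norm_num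

theorem vertexWeight_mono (h : N ⊆ M) : vertexWeight G N v ≤ vertexWeight G M v := by
  by_cases h1 : (partners G M v).Nonempty
  · rw [vertexWeight_of_partners h1]
    unfold vertexWeight; split_ifs <;> norm_num
  · have h2 : partners G N v = ∅ := by
      rw [← Finset.subset_empty, ← Finset.not_nonempty_iff_eq_empty.1 h1]
      exact partners_mono h
    by_cases h3 : (nbrs G M v).Nonempty
    · exact (vertexWeight_le_of_partners h2).trans (le_vertexWeight h3)
    · have h4 : nbrs G N v = ∅ := by
        rw [← Finset.subset_empty, ← Finset.not_nonempty_iff_eq_empty.1 h3]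
        exact nbrs_mono h
      have : vertexWeight G N v = 1 := by unfold vertexWeight; rw [if_pos h4]
      rw [this]; exact one_le_vertexWeight

-- Vertex weights never increase when the set shrinks, and a deleted vertex counts as 1. So it
-- suffices to record the vertices of `R` whose weight drops, by factors `c`; all savings below come
-- from this comparison.
open Classical in
theorem weight_mul_prod_le {R : Finset V} (hN : N ⊆ M) (hR : R ⊆ M) (c : V → ℝ)
    (h0 : ∀ v ∈ R, 0 ≤ c v)
    (hc : ∀ v ∈ R, (if v ∈ N then vertexWeight G N v else 1) * c v ≤ vertexWeight G M v) :
    weight G N * ∏ v ∈ R, c v ≤ weight G M := by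
  have h1 : weight G N = ∏ v ∈ M, if v ∈ N then vertexWeight G N v else 1 := by
    rw [Finset.prod_ite_mem, Finset.inter_eq_right.2 hN]; rfl
  have h2 : ∏ v ∈ R, c v = ∏ v ∈ M, if v ∈ R then c v else 1 := by
    rw [Finset.prod_ite_mem, Finset.inter_eq_right.2 hR]
  rw [h1, h2, ← Finset.prod_mul_distrib]
  refine Finset.prod_le_prod (fun v _ => mul_nonneg ?_ ?_) fun v hv => ?_
  · split_ifs
    · exact zero_le_one.trans one_le_vertexWeight
    · exact zero_le_one
  · split_ifs with h
    · exact h0 v h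
    · exact zero_le_one
  · by_cases h : v ∈ R
    · rw [if_pos h]; exact hc v h
    · rw [if_neg h, mul_one]
      split_ifs
      · exact vertexWeight_mono hN
      · exact one_le_vertexWeight

/-- `v` no longer contributes to the weight of `N`. -/
def Gone (G : Digraph V) (N : Finset V) (v : V) : Prop := v ∈ N → nbrs G N v = ∅

open Classical in
theorem Gone.eq_one (h : Gone G N v) : (if v ∈ N then vertexWeight G N v else 1) = 1 := by
  split_ifs with hv
  · unfold vertexWeight; rw [if_pos (h hv)]
  · rfl

theorem weight_mul_prod_le_of_gone {R : Finset V} (hN : N ⊆ M) (hR : R ⊆ M)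
    (h : ∀ v ∈ R, Gone G N v) : weight G N * ∏ v ∈ R, vertexWeight G M v ≤ weight G M :=
  weight_mul_prod_le hN hR _ (fun _ _ => zero_le_one.trans one_le_vertexWeight)
    fun v hv => by rw [(h v hv).eq_one, one_mul]

theorem weight_mul_pow_le {R : Finset V} (hN : N ⊆ M) (hR : R ⊆ M)
    (h : ∀ v ∈ R, Gone G N v) (hM : ∀ v ∈ R, (nbrs G M v).Nonempty) {k : ℕ} (hk : k ≤ R.card) :
    weight G N * (323 / 250) ^ k ≤ weight G M := by
  refine le_trans ?_ (weight_mul_prod_le_of_gone hN hR h)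
  refine mul_le_mul_of_nonneg_left ?_ (zero_le_one.trans one_le_weight)
  calc (323 / 250 : ℝ) ^ k ≤ (323 / 250) ^ R.card := pow_le_pow_right₀ (by norm_num) hk
    _ = ∏ v ∈ R, (323 / 250 : ℝ) := (Finset.prod_const _).symm
    _ ≤ _ := Finset.prod_le_prod (fun _ _ => by norm_num) fun v hv => le_vertexWeight (hM v hv)

open Classical in
/-- A factor that is larger when the next branching is not guaranteed to be a good one. -/
noncomputable def penalty (G : Digraph V) (N : Finset V) : ℝ :=
  if (∀ v ∈ N, partners G N v = ∅) ∧
    ∃ v ∈ N, (attackers G N v).card = 1 ∧ (targets G N v).Nonempty then 1 else 43 / 40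

/-- The bound on the number of leaves of the search below a defended set. -/
noncomputable def potential (G : Digraph V) (N : Finset V) : ℝ := penalty G N * weight G N

theorem one_le_penalty : 1 ≤ penalty G N := by unfold penalty; split_ifs <;> norm_num

theorem penalty_le : penalty G N ≤ 43 / 40 := by unfold penalty; split_ifs <;> norm_num

theorem one_le_potential : 1 ≤ potential G N :=
  one_le_mul_of_one_le_of_one_le one_le_penalty one_le_weight

theorem potential_le : potential G N ≤ 43 / 40 * weight G N :=
  mul_le_mul_of_nonneg_right penalty_le (zero_le_one.trans one_le_weight)

/-- The candidates for the vertex to branch on, in order of decreasing priority. -/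
def PivotRule (G : Digraph V) (M : Finset V) : ℕ → V → Prop
  | 0, v => v ∈ M ∧ 1 ≤ (partners G M v).card ∧
      (3 ≤ (nbrs G M v).card ∨ 2 ≤ (partners G M v).card)
  | 1, v => v ∈ M ∧ 1 ≤ (partners G M v).card ∧ 2 ≤ (nbrs G M v).card
  | 2, v => v ∈ M ∧ 1 ≤ (partners G M v).card
  | 3, u => u ∈ M ∧ ∃ v, v ∈ M ∧ G.Adj u v ∧ ¬ 2 ≤ (attackers G M v).card ∧
      1 ≤ (targets G M v).card
  | 4, u => u ∈ M ∧ ∃ v, v ∈ M ∧ G.Adj u v ∧ ¬ 2 ≤ (attackers G M v).card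
  | 5, v => v ∈ M ∧ 5 ≤ (nbrs G M v).card
  | 6, v => v ∈ M ∧ 1 ≤ (nbrs G M v).card
  | _, _ => False

/-- `v` satisfies the first rule that is satisfied by some vertex. -/
def IsPivot (G : Digraph V) (M : Finset V) (v : V) : Prop :=
  ∃ k, PivotRule G M k v ∧ ∀ j < k, ∀ u, ¬ PivotRule G M j u

end Weights

end AF

namespace AF

/-! ### Analysis of the branching rules -/

section Branching

variable {V : Type*} {G : Digraph V} {M N N₁ N₂ : Finset V} {u v x : V}

theorem nbrs_nonempty_symm (hv : v ∈ M) (h : u ∈ nbrs G M v) : (nbrs G M u).Nonempty :=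
  ⟨v, mem_nbrs.2 ⟨hv, (mem_nbrs.1 h).2.symm⟩⟩

theorem gone_of_notMem (h : v ∉ N) : Gone G N v := fun h' => absurd h' h

theorem notMem_nbrs_self (hl : ∀ v ∈ M, ¬ G.Adj v v) : v ∉ nbrs G M v := fun h =>
  hl v (mem_nbrs.1 h).1 (by simpa using (mem_nbrs.1 h).2)

/-- An unattacked `v` makes its targets indefensible. This is how one deletion propagates through
pruning. -/
theorem Defended.notMem_of_adj (hN : Defended G N) (h : ∀ w ∈ N, ¬ G.Adj w v)
    (hx : G.Adj v x) : x ∉ N := fun hxN =>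
  let ⟨w, hw, hwv⟩ := hN x hxN v hx
  h w hw hwv

theorem eq_of_mem_attackers (h : ¬ 2 ≤ (attackers G M v).card) {a b : V}
    (ha : a ∈ attackers G M v) (hb : b ∈ attackers G M v) : a = b :=
  Finset.card_le_one.1 (by omega) a ha b hb

theorem Defended.gone_of_not_adj (hN : Defended G N) (h : ∀ w ∈ N, ¬ G.Adj w v) :
    Gone G N v := by
  intro _
  rw [Finset.eq_empty_iff_forall_notMem]
  intro w hw
  rcases (mem_nbrs.1 hw).2 with h' | h'
  · exact hN.notMem_of_adj h h' (mem_nbrs.1 hw).1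
  · exact h w (mem_nbrs.1 hw).1 h'

theorem not_adj_symm (ho : ∀ u, ¬ PivotRule G M 2 u) (hu : u ∈ M) (hv : v ∈ M)
    (h : G.Adj u v) : ¬ G.Adj v u := fun h' =>
  ho u ⟨hu, Finset.card_pos.2 ⟨v, mem_partners.2 ⟨hv, h, h'⟩⟩⟩

theorem partners_eq_empty (ho : ∀ u, ¬ PivotRule G M 2 u) (hu : u ∈ M) : partners G M u = ∅ := by
  rw [Finset.eq_empty_iff_forall_notMem]
  exact fun w hw => ho u ⟨hu, Finset.card_pos.2 ⟨w, hw⟩⟩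

theorem attackers_nonempty (hM : Defended G M) (h : (nbrs G M v).Nonempty) :
    (attackers G M v).Nonempty := by
  obtain ⟨w, hw⟩ := h
  rw [mem_nbrs] at hw
  rcases hw.2 with h' | h'
  · obtain ⟨z, hz, hzv⟩ := hM w hw.1 v h'
    exact ⟨z, mem_attackers.2 ⟨hz, hzv⟩⟩
  · exact ⟨w, mem_attackers.2 ⟨hw.1, h'⟩⟩

theorem penalty_eq_of_partners (hv : v ∈ M) (h : 1 ≤ (partners G M v).card) :
    penalty G M = 43 / 40 := by
  unfold penalty
  rw [if_neg]
  rintro ⟨h', -⟩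
  rw [h' v hv, Finset.card_empty] at h
  omega

/-- A vertex that lowers the penalty to 1 has a unique attacker, and this attacker would satisfy
rule 3. So every later rule starts from the full factor. -/
theorem penalty_eq_of_rule_three (h3 : ∀ u, ¬ PivotRule G M 3 u) : penalty G M = 43 / 40 := by
  unfold penalty
  rw [if_neg]
  rintro ⟨-, v, hv, hc, ht⟩
  obtain ⟨u, hu⟩ := Finset.card_pos.1 (by omega : 0 < (attackers G M v).card)
  rw [mem_attackers] at hu
  exact h3 u ⟨hu.1, v, hv, hu.2, by omega, Finset.card_pos.2 ht⟩

theorem IsPivot.mem_and_nonempty (hv : IsPivot G M v) : v ∈ M ∧ (nbrs G M v).Nonempty := by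
  obtain ⟨k, hk, -⟩ := hv
  have hpart : 1 ≤ (partners G M v).card → (nbrs G M v).Nonempty := fun h =>
    (Finset.card_pos.1 h).mono partners_subset_nbrs
  match k, hk with
  | 0, hk => exact ⟨hk.1, hpart hk.2.1⟩
  | 1, hk => exact ⟨hk.1, hpart hk.2.1⟩
  | 2, hk => exact ⟨hk.1, hpart hk.2⟩
  | 3, ⟨h, w, hw, ha, _⟩ => exact ⟨h, w, mem_nbrs.2 ⟨hw, Or.inl ha⟩⟩
  | 4, ⟨h, w, hw, ha, _⟩ => exact ⟨h, w, mem_nbrs.2 ⟨hw, Or.inl ha⟩⟩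
  | 5, hk => exact ⟨hk.1, Finset.card_pos.1 (by have := hk.2; omega)⟩
  | 6, hk => exact ⟨hk.1, Finset.card_pos.1 (by have := hk.2; omega)⟩

variable [DecidableEq V]

theorem gone_of_subset_sdiff (h : N ⊆ M \ nbrs G M v) (hu : u ∈ insert v (nbrs G M v)) :
    Gone G N u := by
  intro huN
  rcases Finset.mem_insert.1 hu with rfl | hu
  · rw [Finset.eq_empty_iff_forall_notMem]
    intro w hw
    have hw' := Finset.mem_sdiff.1 (h (mem_nbrs.1 hw).1)
    exact hw'.2 (mem_nbrs.2 ⟨hw'.1, (mem_nbrs.1 hw).2⟩)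
  · exact absurd hu (Finset.mem_sdiff.1 (h huN)).2

theorem insert_nbrs_subset (hv : v ∈ M) : insert v (nbrs G M v) ⊆ M :=
  Finset.insert_subset hv fun _ h => (mem_nbrs.1 h).1

theorem nonempty_of_mem_insert_nbrs (hv : v ∈ M) (hn : (nbrs G M v).Nonempty)
    (hu : u ∈ insert v (nbrs G M v)) : (nbrs G M u).Nonempty := by
  rcases Finset.mem_insert.1 hu with rfl | hu
  · exact hn
  · exact nbrs_nonempty_symm hv hu

/-- The neighbours of `v` are deleted and `v` becomes isolated: `k + 2` vertices stop counting. `N`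
is only required to be a subset because pruning may shrink it further. -/
theorem weight_in_le (hl : ∀ v ∈ M, ¬ G.Adj v v) (hv : v ∈ M) (h : N ⊆ M \ nbrs G M v) {k : ℕ}
    (hk : k + 1 ≤ (nbrs G M v).card) : weight G N * (323 / 250) ^ (k + 2) ≤ weight G M := by
  refine weight_mul_pow_le (h.trans Finset.sdiff_subset) (insert_nbrs_subset hv)
    (fun u hu => gone_of_subset_sdiff h hu)
    (fun u hu => nonempty_of_mem_insert_nbrs hv (Finset.card_pos.1 (by omega)) hu) ?_
  rw [Finset.card_insert_of_notMem (notMem_nbrs_self hl)]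
  omega

theorem weight_in_le_of_partner (hl : ∀ v ∈ M, ¬ G.Adj v v) (hv : v ∈ M)
    (h : N ⊆ M \ nbrs G M v) (hu : u ∈ partners G M v) {k : ℕ}
    (hk : k + 1 ≤ (nbrs G M v).card) :
    weight G N * ((37 / 25) ^ 2 * (323 / 250) ^ k) ≤ weight G M := by
  refine le_trans ?_ (weight_mul_prod_le_of_gone (h.trans Finset.sdiff_subset)
    (insert_nbrs_subset hv) (fun u hu => gone_of_subset_sdiff h hu))
  refine mul_le_mul_of_nonneg_left ?_ (zero_le_one.trans one_le_weight)
  have hun := partners_subset_nbrs hu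
  have hu' := mem_partners.1 hu
  rw [Finset.prod_insert (notMem_nbrs_self hl), ← Finset.mul_prod_erase _ _ hun,
    vertexWeight_of_partners ⟨u, hu⟩,
    vertexWeight_of_partners ⟨v, mem_partners.2 ⟨hv, hu'.2.2, hu'.2.1⟩⟩, pow_two, mul_assoc]
  refine mul_le_mul_of_nonneg_left (mul_le_mul_of_nonneg_left ?_ (by norm_num)) (by norm_num)
  have hc := Finset.card_erase_of_mem hun
  calc (323 / 250 : ℝ) ^ k ≤ (323 / 250) ^ ((nbrs G M v).erase u).card :=
        pow_le_pow_right₀ (by norm_num) (by omega)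
    _ = ∏ v ∈ (nbrs G M v).erase u, (323 / 250 : ℝ) := (Finset.prod_const _).symm
    _ ≤ _ := Finset.prod_le_prod (fun _ _ => by norm_num) fun w hw =>
        le_vertexWeight (nbrs_nonempty_symm hv (Finset.mem_of_mem_erase hw))

theorem weight_in_le_of_partners (hl : ∀ v ∈ M, ¬ G.Adj v v) (hv : v ∈ M)
    (h : N ⊆ M \ nbrs G M v) (hp : 2 ≤ (partners G M v).card) :
    weight G N * (37 / 25) ^ 3 ≤ weight G M := by
  have hsub : insert v (partners G M v) ⊆ insert v (nbrs G M v) :=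
    Finset.insert_subset_insert _ partners_subset_nbrs
  refine le_trans ?_ (weight_mul_prod_le_of_gone (R := insert v (partners G M v))
    (h.trans Finset.sdiff_subset)
    (hsub.trans (insert_nbrs_subset hv)) (fun u hu => gone_of_subset_sdiff h (hsub hu)))
  refine mul_le_mul_of_nonneg_left ?_ (zero_le_one.trans one_le_weight)
  have hc := Finset.card_insert_of_notMem
    (fun h => notMem_nbrs_self hl (partners_subset_nbrs (G := G) (M := M) h) : v ∉ partners G M v)
  calc (37 / 25 : ℝ) ^ 3 ≤ (37 / 25) ^ (insert v (partners G M v)).card :=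
        pow_le_pow_right₀ (by norm_num) (by omega)
    _ = ∏ v ∈ insert v (partners G M v), (37 / 25 : ℝ) := (Finset.prod_const _).symm
    _ ≤ _ := Finset.prod_le_prod (fun _ _ => by norm_num) fun w hw => by
        rcases Finset.mem_insert.1 hw with rfl | hw
        · rw [vertexWeight_of_partners (Finset.card_pos.1 (by omega))]
        · have hw' := mem_partners.1 hw
          rw [vertexWeight_of_partners ⟨v, mem_partners.2 ⟨hv, hw'.2.2, hw'.2.1⟩⟩]

theorem weight_out_le_of_partner (hv : v ∈ M) (h : N ⊆ M.erase v)
    (hp : (partners G M v).Nonempty) : weight G N * (37 / 25) ≤ weight G M := by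
  have hvN : v ∉ N := fun hh => Finset.notMem_erase v M (h hh)
  have := weight_mul_prod_le_of_gone (R := {v}) (h.trans (Finset.erase_subset _ _))
    (by simpa using hv) (by simpa using gone_of_notMem hvN) (G := G)
  rwa [Finset.prod_singleton, vertexWeight_of_partners hp] at this

theorem weight_out_le (hv : v ∈ M) (h : N ⊆ M.erase v)
    (hp : (nbrs G M v).Nonempty) : weight G N * (323 / 250) ≤ weight G M := by
  have hvN : v ∉ N := fun hh => Finset.notMem_erase v M (h hh)
  have := weight_mul_pow_le (R := {v}) (k := 1) (h.trans (Finset.erase_subset _ _))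
    (by simpa using hv) (by simpa using gone_of_notMem hvN) (G := G) (by simpa using hp) (by simp)
  rwa [pow_one] at this

theorem branch_le_of_rule_zero (hl : ∀ v ∈ M, ¬ G.Adj v v) (hv : PivotRule G M 0 v)
    (h₁ : N₁ ⊆ M \ nbrs G M v) (h₂ : N₂ ⊆ M.erase v) :
    weight G N₁ + weight G N₂ ≤ weight G M := by
  obtain ⟨hvM, hp, hr⟩ := hv
  have hp' := Finset.card_pos.1 hp
  have h2 := weight_out_le_of_partner hvM h₂ hp'
  have h0 : 1 ≤ weight G M := one_le_weight
  rcases hr with hr | hr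
  · obtain ⟨u, hu⟩ := hp'
    have h1 := weight_in_le_of_partner hl hvM h₁ hu (k := 2) hr
    norm_num at h1
    linarith
  · have h1 := weight_in_le_of_partners hl hvM h₁ hr
    norm_num at h1
    linarith

/-- Since rule 0 fails, a partner `u` of `v` has no other partner. Leaving `v` out thus takes `u`
off all 2-cycles, and its weight drops from 37/25 to at most 323/250. -/
theorem branch_le_of_rule_one (hl : ∀ v ∈ M, ¬ G.Adj v v) (hv : PivotRule G M 1 v)
    (h : ∀ u, ¬ PivotRule G M 0 u)
    (h₁ : N₁ ⊆ M \ nbrs G M v) (h₂ : N₂ ⊆ M.erase v) :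
    weight G N₁ + weight G N₂ ≤ weight G M := by
  obtain ⟨hvM, hp, hr⟩ := hv
  obtain ⟨u, hu⟩ := Finset.card_pos.1 hp
  have hu' := mem_partners.1 hu
  have hvu : v ∈ partners G M u := mem_partners.2 ⟨hvM, hu'.2.2, hu'.2.1⟩
  have h0 : 1 ≤ weight G M := one_le_weight
  have h1 := weight_in_le_of_partner hl hvM h₁ hu (k := 1) hr
  have hvN : v ∉ N₂ := fun hh => Finset.notMem_erase v M (h₂ hh)
  have huv : v ≠ u := fun e => hl v hvM (by simpa [e] using hu'.2.1)
  have hsub := h₂.trans (Finset.erase_subset _ _)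
  have hpu : partners G N₂ u = ∅ := by
    rw [Finset.eq_empty_iff_forall_notMem]
    intro w hw
    refine h u ⟨hu'.1, Finset.card_pos.2 ⟨v, hvu⟩, Or.inr ?_⟩
    refine Finset.one_lt_card.2 ⟨w, partners_mono hsub hw, v, hvu, ?_⟩
    rintro rfl
    exact hvN (mem_partners.1 hw).1
  have h2 := weight_mul_prod_le (G := G) (R := {v, u}) hsub
    (by simp [Finset.insert_subset_iff, hvM, hu'.1])
    (fun w => if w = v then 37 / 25 else 37 / 25 / (323 / 250))
    (fun w _ => by split_ifs <;> norm_num) (by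
      intro w hw
      rcases Finset.mem_insert.1 hw with rfl | hw
      · rw [(gone_of_notMem hvN).eq_one, if_pos rfl, vertexWeight_of_partners ⟨u, hu⟩, one_mul]
      · rw [Finset.mem_singleton] at hw
        subst hw
        rw [if_neg huv.symm, vertexWeight_of_partners ⟨v, hvu⟩]
        have h3 := vertexWeight_le_of_partners hpu
        split_ifs
        · norm_num; linarith
        · norm_num)
  rw [Finset.prod_pair huv, if_pos rfl, if_neg huv.symm] at h2
  norm_num at h1 h2
  linarith

/-- Since rule 1 fails, a partner `u` of `v` has no other neighbour. Both vertices stop counting in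
either branch, and 2 ≤ 1.48^2. -/
theorem branch_le_of_rule_two (hl : ∀ v ∈ M, ¬ G.Adj v v) (hv : PivotRule G M 2 v)
    (h : ∀ u, ¬ PivotRule G M 1 u)
    (h₁ : N₁ ⊆ M \ nbrs G M v) (h₂ : N₂ ⊆ M.erase v) :
    weight G N₁ + weight G N₂ ≤ weight G M := by
  obtain ⟨hvM, hp⟩ := hv
  obtain ⟨u, hu⟩ := Finset.card_pos.1 hp
  have hu' := mem_partners.1 hu
  have hvu : v ∈ partners G M u := mem_partners.2 ⟨hvM, hu'.2.2, hu'.2.1⟩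
  have h0 : 1 ≤ weight G M := one_le_weight
  have h1 := weight_in_le_of_partner hl hvM h₁ hu (k := 0)
    (Finset.card_pos.2 ⟨u, partners_subset_nbrs hu⟩)
  have hvN : v ∉ N₂ := fun hh => Finset.notMem_erase v M (h₂ hh)
  have huv : v ≠ u := fun e => hl v hvM (by simpa [e] using hu'.2.1)
  have hsub := h₂.trans (Finset.erase_subset _ _)
  have hgu : Gone G N₂ u := by
    intro _
    rw [Finset.eq_empty_iff_forall_notMem]
    intro w hw
    refine h u ⟨hu'.1, Finset.card_pos.2 ⟨v, hvu⟩, ?_⟩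
    refine Finset.one_lt_card.2 ⟨w, nbrs_mono hsub hw, v, partners_subset_nbrs hvu, ?_⟩
    rintro rfl
    exact hvN (mem_nbrs.1 hw).1
  have h2 := weight_mul_prod_le_of_gone (G := G) (R := {v, u}) hsub
    (by simp [Finset.insert_subset_iff, hvM, hu'.1]) (by
      intro w hw
      rcases Finset.mem_insert.1 hw with rfl | hw
      · exact gone_of_notMem hvN
      · rw [Finset.mem_singleton] at hw
        exact hw ▸ hgu)
  rw [Finset.prod_pair huv, vertexWeight_of_partners ⟨v, hvu⟩,
    vertexWeight_of_partners ⟨u, hu⟩] at h2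
  norm_num at h1 h2
  linarith

/-- If the only attacker of `v` is deleted, then the targets of `v` are deleted and `v` becomes
isolated. -/
theorem not_adj_of_attackers (h₂ : N ⊆ M.erase u) (huM : u ∈ M) (huv : G.Adj u v)
    (hc : ¬ 2 ≤ (attackers G M v).card) : ∀ w ∈ N, ¬ G.Adj w v := by
  intro w hw hwv
  have hw' := Finset.mem_erase.1 (h₂ hw)
  exact hw'.1 (eq_of_mem_attackers hc (mem_attackers.2 ⟨hw'.2, hwv⟩)
    (mem_attackers.2 ⟨huM, huv⟩))

/-- Each branch loses three vertices: `u`, `v` and a defender `z` of `v` when `u` is in; `u`, the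
now unattacked `v` and its target `x` when `u` is out. As 1.292^3 exceeds 2 · 43/40, the bound even
allows both children the full penalty while charging the parent none. -/
theorem branch_le_of_rule_three (hl : ∀ v ∈ M, ¬ G.Adj v v) (hM : Defended G M)
    (hu : PivotRule G M 3 u) (ho : ∀ u, ¬ PivotRule G M 2 u)
    (h₁ : N₁ ⊆ M \ nbrs G M u) (h₂ : N₂ ⊆ M.erase u) (hN₂ : Defended G N₂) :
    43 / 40 * weight G N₁ + 43 / 40 * weight G N₂ ≤ weight G M := by
  obtain ⟨huM, v, hvM, huv, hc, ht⟩ := hu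
  obtain ⟨x, hx⟩ := Finset.card_pos.1 ht
  rw [mem_targets] at hx
  obtain ⟨z, hz, hzu⟩ := hM v hvM u huv
  have h0 : 1 ≤ weight G M := one_le_weight
  have hzv : z ≠ v := fun e => not_adj_symm ho huM hvM huv (e ▸ hzu)
  have hvn : v ∈ nbrs G M u := mem_nbrs.2 ⟨hvM, Or.inl huv⟩
  have hzn : z ∈ nbrs G M u := mem_nbrs.2 ⟨hz, Or.inr hzu⟩
  have h1 := weight_in_le hl huM h₁ (k := 1) (Finset.one_lt_card.2 ⟨z, hzn, v, hvn, hzv⟩)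
  have hna := not_adj_of_attackers h₂ huM huv hc
  have hu0 : u ≠ v := fun e => hl u huM (by simpa [e] using huv)
  have hvx : v ≠ x := fun e => hl v hvM (by simpa [e] using hx.2)
  have hux : u ≠ x := fun e => not_adj_symm ho huM hvM huv (e ▸ hx.2)
  have h2 := weight_mul_pow_le (G := G) (R := {u, v, x}) (k := 3)
    (h₂.trans (Finset.erase_subset _ _))
    (by simp [Finset.insert_subset_iff, huM, hvM, hx.1])
    (by
      simp only [Finset.mem_insert, Finset.mem_singleton, forall_eq_or_imp, forall_eq]
      exact ⟨gone_of_notMem fun hh => Finset.notMem_erase u M (h₂ hh),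
        hN₂.gone_of_not_adj hna, gone_of_notMem (hN₂.notMem_of_adj hna hx.2)⟩)
    (by
      simp only [Finset.mem_insert, Finset.mem_singleton, forall_eq_or_imp, forall_eq]
      exact ⟨⟨v, hvn⟩, nbrs_nonempty_symm huM hvn, ⟨v, mem_nbrs.2 ⟨hvM, Or.inr hx.2⟩⟩⟩)
    (by rw [Finset.card_eq_three.2 ⟨u, v, x, hu0, hux, hvx, rfl⟩])
  norm_num at h1 h2
  linarith

/-- If `u` had a single attacker, that attacker would satisfy rule 3, with `v` as the target of `u`.
So `u` has two attackers besides its target `v`: four vertices are lost when `u` is in, and `u`, `v`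
when it is out. -/
theorem branch_le_of_rule_four (hl : ∀ v ∈ M, ¬ G.Adj v v) (hM : Defended G M)
    (hu : PivotRule G M 4 u) (ho : ∀ u, ¬ PivotRule G M 2 u) (h3 : ∀ u, ¬ PivotRule G M 3 u)
    (h₁ : N₁ ⊆ M \ nbrs G M u) (h₂ : N₂ ⊆ M.erase u) (hN₂ : Defended G N₂) :
    weight G N₁ + weight G N₂ ≤ weight G M := by
  obtain ⟨huM, v, hvM, huv, hc⟩ := hu
  obtain ⟨z, hz, hzu⟩ := hM v hvM u huv
  have h0 : 1 ≤ weight G M := one_le_weight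
  have hvn : v ∈ nbrs G M u := mem_nbrs.2 ⟨hvM, Or.inl huv⟩
  have hcu : 2 ≤ (attackers G M u).card := by
    by_contra hcu
    exact h3 z ⟨hz, u, huM, hzu, hcu, Finset.card_pos.2 ⟨v, mem_targets.2 ⟨hvM, huv⟩⟩⟩
  have hva : v ∉ attackers G M u := fun hh =>
    not_adj_symm ho huM hvM huv (mem_attackers.1 hh).2
  have hcard : 3 ≤ (nbrs G M u).card := by
    have : insert v (attackers G M u) ⊆ nbrs G M u := Finset.insert_subset hvn fun w hw =>
      mem_nbrs.2 ⟨(mem_attackers.1 hw).1, Or.inr (mem_attackers.1 hw).2⟩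
    have := Finset.card_le_card this
    rw [Finset.card_insert_of_notMem hva] at this
    omega
  have h1 := weight_in_le hl huM h₁ (k := 2) hcard
  have hna := not_adj_of_attackers h₂ huM huv hc
  have hu0 : u ≠ v := fun e => hl u huM (by simpa [e] using huv)
  have h2 := weight_mul_pow_le (G := G) (R := {u, v}) (k := 2)
    (h₂.trans (Finset.erase_subset _ _))
    (by simp [Finset.insert_subset_iff, huM, hvM])
    (by
      simp only [Finset.mem_insert, Finset.mem_singleton, forall_eq_or_imp, forall_eq]
      exact ⟨gone_of_notMem fun hh => Finset.notMem_erase u M (h₂ hh),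
        hN₂.gone_of_not_adj hna⟩)
    (by
      simp only [Finset.mem_insert, Finset.mem_singleton, forall_eq_or_imp, forall_eq]
      exact ⟨⟨v, hvn⟩, nbrs_nonempty_symm huM hvn⟩)
    (by rw [Finset.card_pair hu0])
  norm_num at h1 h2
  linarith

theorem branch_le_of_rule_five (hl : ∀ v ∈ M, ¬ G.Adj v v) (hv : PivotRule G M 5 v)
    (h₁ : N₁ ⊆ M \ nbrs G M v) (h₂ : N₂ ⊆ M.erase v) :
    weight G N₁ + weight G N₂ ≤ weight G M := by
  obtain ⟨hvM, hc⟩ := hv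
  have h0 : 1 ≤ weight G M := one_le_weight
  have h1 := weight_in_le hl hvM h₁ (k := 4) hc
  have h2 := weight_out_le (G := G) hvM h₂ (Finset.card_pos.1 (by omega))
  norm_num at h1 h2
  linarith

theorem card_attackers_add_card_targets (ho : ∀ u, ¬ PivotRule G M 2 u) (hv : v ∈ M) :
    (attackers G M v).card + (targets G M v).card = (nbrs G M v).card := by
  rw [← Finset.card_union_of_disjoint]
  · congr 1
    ext w
    simp only [Finset.mem_union, mem_attackers, mem_targets, mem_nbrs]
    tauto
  · rw [Finset.disjoint_left]
    intro w h h'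
    rw [mem_attackers] at h
    rw [mem_targets] at h'
    exact not_adj_symm ho h.1 hv h.2 h'.2

open Classical in
/-- Without 2-cycles, if no vertex has exactly one attacker and none has more than four
neighbours, then every non-isolated vertex has two attackers and two targets. -/
theorem card_targets_eq_two (hM : Defended G M) (ho : ∀ u, ¬ PivotRule G M 2 u)
    (h4 : ∀ u, ¬ PivotRule G M 4 u) (h5 : ∀ u, ¬ PivotRule G M 5 u) (hv : v ∈ M)
    (hn : (nbrs G M v).Nonempty) :
    (attackers G M v).card = 2 ∧ (targets G M v).card = 2 := by
  have hle : ∀ v ∈ M, (nbrs G M v).Nonempty →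
      2 ≤ (attackers G M v).card ∧ (targets G M v).card ≤ 2 := by
    intro v hv hn
    have h1 : 2 ≤ (attackers G M v).card := by
      by_contra hc
      obtain ⟨u, hu⟩ := attackers_nonempty hM hn
      rw [mem_attackers] at hu
      exact h4 u ⟨hu.1, v, hv, hu.2, hc⟩
    have h2 := card_attackers_add_card_targets ho hv
    have h3 : ¬ 5 ≤ (nbrs G M v).card := fun h => h5 v ⟨hv, h⟩
    omega
  have hle' : ∀ v ∈ M, (targets G M v).card ≤ (attackers G M v).card := by
    intro v hv
    by_cases hn : (nbrs G M v).Nonempty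
    · have := hle v hv hn; omega
    · have := card_attackers_add_card_targets ho hv
      rw [Finset.not_nonempty_iff_eq_empty.1 hn, Finset.card_empty] at this
      omega
  -- Both sums count the arcs inside `M`; with the vertexwise inequality this forces equality at
  -- every vertex.
  have hsum : ∑ v ∈ M, (targets G M v).card = ∑ v ∈ M, (attackers G M v).card :=
    Finset.sum_card_bipartiteAbove_eq_sum_card_bipartiteBelow (s := M) (t := M) G.Adj
  have := (Finset.sum_eq_sum_iff_of_le hle').1 hsum v hv
  have := hle v hv hn
  omega

/-- Without `v`, at most one attacker of `x` is left. If `x` is still in conflict it has exactly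
one, by defence, and a remaining target of `x` would then make the penalty 1. -/
theorem Defended.target_cases (ho : ∀ u, ¬ PivotRule G M 2 u) (hNM : N ⊆ M.erase v)
    (hN : Defended G N) (hv : v ∈ M) (hvx : G.Adj v x) (hc : (attackers G M x).card = 2)
    (hp : penalty G N ≠ 1) : Gone G N x ∨ ∀ y ∈ N, ¬ G.Adj x y := by
  by_contra! hcon
  obtain ⟨hg, y, hy, hxy⟩ := hcon
  unfold Gone at hg
  push Not at hg
  obtain ⟨hxN, hn⟩ := hg
  have hsub := hNM.trans (Finset.erase_subset _ _)
  refine hp ?_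
  unfold penalty
  rw [if_pos]
  refine ⟨fun w hw => ?_, x, hxN, ?_, ⟨y, mem_targets.2 ⟨hy, hxy⟩⟩⟩
  · rw [← Finset.subset_empty, ← partners_eq_empty ho (hsub hw)]
    exact partners_mono hsub
  · have h1 := Finset.card_pos.2 (attackers_nonempty hN hn)
    have h2 : attackers G N x ⊆ (attackers G M x).erase v := fun w hw =>
      Finset.mem_erase.2 ⟨(Finset.mem_erase.1 (hNM (mem_attackers.1 hw).1)).1,
        mem_attackers.2 ⟨hsub (mem_attackers.1 hw).1, (mem_attackers.1 hw).2⟩⟩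
    have h3 := Finset.card_le_card h2
    rw [Finset.card_erase_of_mem (mem_attackers.2 ⟨hv, hvx⟩)] at h3
    omega

theorem branch_le_of_rule_six (hl : ∀ v ∈ M, ¬ G.Adj v v) (hM : Defended G M)
    (hv : PivotRule G M 6 v) (ho : ∀ u, ¬ PivotRule G M 2 u)
    (h4 : ∀ u, ¬ PivotRule G M 4 u) (h5 : ∀ u, ¬ PivotRule G M 5 u)
    (h₁ : N₁ ⊆ M \ nbrs G M v) (h₂ : N₂ ⊆ M.erase v) (hN₂ : Defended G N₂) :
    43 / 40 * weight G N₁ + potential G N₂ ≤ 43 / 40 * weight G M := by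
  obtain ⟨hvM, hn⟩ := hv
  replace hn := Finset.card_pos.1 hn
  have h0 : 1 ≤ weight G M := one_le_weight
  have hreg := fun {v} hv hn => card_targets_eq_two (v := v) hM ho h4 h5 hv hn
  have hcv := hreg hvM hn
  have h1 := weight_in_le hl hvM h₁ (k := 3)
    (by rw [← card_attackers_add_card_targets ho hvM]; omega)
  have hvg : Gone G N₂ v := gone_of_notMem fun hh => Finset.notMem_erase v M (h₂ hh)
  have hsub := h₂.trans (Finset.erase_subset _ _)
  by_cases hp : penalty G N₂ = 1
  -- The reduced penalty pays for this branch: only `v` itself is counted as lost, and c/1.292^5 +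
  -- 1/1.292 ≤ c for c = 43/40.
  · have h2 := weight_out_le hvM h₂ hn
    rw [potential, hp]
    norm_num at h1 h2
    linarith
  · have h2 := potential_le (G := G) (N := N₂)
    suffices weight G N₂ * (323 / 250) ^ 3 ≤ weight G M by
      norm_num at h1 this
      linarith
    -- Besides `v` two more vertices are lost: both targets of `v`, or, if some target `x` survives,
    -- both targets of `x`. The absence of 2-cycles keeps the latter distinct from `v`.
    have key : ∃ a b, a ∈ M ∧ b ∈ M ∧ a ≠ b ∧ a ≠ v ∧ b ≠ v ∧ Gone G N₂ a ∧ Gone G N₂ b ∧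
        (nbrs G M a).Nonempty ∧ (nbrs G M b).Nonempty := by
      by_cases hall : ∀ x ∈ targets G M v, Gone G N₂ x
      · obtain ⟨a, b, hab, he⟩ := Finset.card_eq_two.1 hcv.2
        have ha : a ∈ targets G M v := by simp [he]
        have hb : b ∈ targets G M v := by simp [he]
        have ha' := mem_targets.1 ha
        have hb' := mem_targets.1 hb
        exact ⟨a, b, ha'.1, hb'.1, hab, fun e => hl v hvM (by simpa [e] using ha'.2),
          fun e => hl v hvM (by simpa [e] using hb'.2), hall a ha, hall b hb,
          ⟨v, mem_nbrs.2 ⟨hvM, Or.inr ha'.2⟩⟩, ⟨v, mem_nbrs.2 ⟨hvM, Or.inr hb'.2⟩⟩⟩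
      · push Not at hall
        obtain ⟨x, hx, hxg⟩ := hall
        rw [mem_targets] at hx
        have hcx := hreg hx.1 ⟨v, mem_nbrs.2 ⟨hvM, Or.inr hx.2⟩⟩
        have hno := (Defended.target_cases ho h₂ hN₂ hvM hx.2 hcx.1 hp).resolve_left hxg
        obtain ⟨a, b, hab, he⟩ := Finset.card_eq_two.1 hcx.2
        have ha : a ∈ targets G M x := by simp [he]
        have hb : b ∈ targets G M x := by simp [he]
        rw [mem_targets] at ha hb
        have hxv := not_adj_symm ho hvM hx.1 hx.2
        exact ⟨a, b, ha.1, hb.1, hab, fun e => hxv (e ▸ ha.2), fun e => hxv (e ▸ hb.2),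
          gone_of_notMem fun h => hno a h ha.2, gone_of_notMem fun h => hno b h hb.2,
          ⟨x, mem_nbrs.2 ⟨hx.1, Or.inr ha.2⟩⟩, ⟨x, mem_nbrs.2 ⟨hx.1, Or.inr hb.2⟩⟩⟩
    obtain ⟨a, b, ha, hb, hab, hav, hbv, hag, hbg, han, hbn⟩ := key
    refine weight_mul_pow_le (R := {v, a, b}) hsub
      (by simp [Finset.insert_subset_iff, hvM, ha, hb]) ?_ ?_
      (by rw [Finset.card_eq_three.2 ⟨v, a, b, hav.symm, hbv.symm, hab, rfl⟩])
    · simp only [Finset.mem_insert, Finset.mem_singleton, forall_eq_or_imp, forall_eq]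
      exact ⟨hvg, hag, hbg⟩
    · simp only [Finset.mem_insert, Finset.mem_singleton, forall_eq_or_imp, forall_eq]
      exact ⟨hn, han, hbn⟩

theorem IsPivot.potential_add_le (hl : ∀ v ∈ M, ¬ G.Adj v v) (hM : Defended G M)
    (hv : IsPivot G M v) (h₁ : N₁ ⊆ M \ nbrs G M v) (h₂ : N₂ ⊆ M.erase v)
    (hN₂ : Defended G N₂) : potential G N₁ + potential G N₂ ≤ potential G M := by
  have p1 := potential_le (G := G) (N := N₁)
  have p2 := potential_le (G := G) (N := N₂)
  have red : penalty G M = 43 / 40 → weight G N₁ + weight G N₂ ≤ weight G M →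
      potential G N₁ + potential G N₂ ≤ potential G M := by
    intro e h
    have : potential G M = 43 / 40 * weight G M := by rw [potential, e]
    linarith
  obtain ⟨k, hk, hlt⟩ := hv
  match k, hk, hlt with
  | 0, hk, _ =>
    exact red (penalty_eq_of_partners hk.1 hk.2.1) (branch_le_of_rule_zero hl hk h₁ h₂)
  | 1, hk, hlt =>
    exact red (penalty_eq_of_partners hk.1 hk.2.1)
      (branch_le_of_rule_one hl hk (hlt 0 (by omega)) h₁ h₂)
  | 2, hk, hlt =>
    exact red (penalty_eq_of_partners hk.1 hk.2)
      (branch_le_of_rule_two hl hk (hlt 1 (by omega)) h₁ h₂)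
  | 3, hk, hlt =>
    have h := branch_le_of_rule_three hl hM hk (hlt 2 (by omega)) h₁ h₂ hN₂
    have : weight G M ≤ potential G M :=
      le_mul_of_one_le_left (zero_le_one.trans one_le_weight) one_le_penalty
    linarith
  | 4, hk, hlt =>
    exact red (penalty_eq_of_rule_three (hlt 3 (by omega)))
      (branch_le_of_rule_four hl hM hk (hlt 2 (by omega)) (hlt 3 (by omega)) h₁ h₂ hN₂)
  | 5, hk, hlt =>
    exact red (penalty_eq_of_rule_three (hlt 3 (by omega)))
      (branch_le_of_rule_five hl hk h₁ h₂)
  | 6, hk, hlt =>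
    have h := branch_le_of_rule_six hl hM hk (hlt 2 (by omega)) (hlt 4 (by omega))
      (hlt 5 (by omega)) h₁ h₂ hN₂
    have : potential G M = 43 / 40 * weight G M := by
      rw [potential, penalty_eq_of_rule_three (hlt 3 (by omega))]
    linarith
  | k + 7, hk, _ => exact hk.elim

end Branching

end AF

namespace AF

/-! ### The search: correctness, output size and number of steps -/

section Search

variable {V : Type*}

theorem Admissible.not_adj_self {G : Digraph V} {S : Finset V} (hS : Admissible G S) {v : V}
    (hv : v ∈ S) : ¬ G.Adj v v := hS.1 v hv v hv

/-- `piv` selects a pivot whenever some rule applies. -/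
def SelectsPivot (G : Digraph V) (piv : Finset V → Option V) : Prop :=
  ∀ M, (∀ v, piv M = some v → IsPivot G M v) ∧
    (piv M = none → ∀ k v, ¬ PivotRule G M k v)

theorem exists_selectsPivot (G : Digraph V) : ∃ piv, SelectsPivot G piv := by
  classical
  refine ⟨fun M => if h : ∃ v, IsPivot G M v then some h.choose else none, fun M => ⟨?_, ?_⟩⟩
  · intro v hv
    dsimp only at hv
    split_ifs at hv with h
    rw [← Option.some.inj hv]
    exact h.choose_spec
  · intro hv k v hk
    dsimp only at hv
    split_ifs at hv with h
    have hex : ∃ k, ∃ v, PivotRule G M k v := ⟨k, v, hk⟩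
    obtain ⟨v, hv⟩ := Nat.find_spec hex
    exact h ⟨v, Nat.find hex, hv, fun j hj u hu => Nat.find_min hex hj ⟨u, hu⟩⟩

variable [Fintype V]

open Classical in
/-- The vertices without a loop. -/
noncomputable def loopless (G : Digraph V) : Finset V := {v | ¬ G.Adj v v}

theorem mem_loopless {G : Digraph V} {v : V} : v ∈ loopless G ↔ ¬ G.Adj v v := by
  simp [loopless]

open Classical in
theorem weight_le {G : Digraph V} {M : Finset V} (hM : M ⊆ loopless G) : weight G M ≤
    (37 / 25) ^ {v | OnTwoCycle G v}.ncard *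
      (323 / 250) ^ (Fintype.card V - {v | OnTwoCycle G v}.ncard) := by
  have hcard : {v | OnTwoCycle G v}.ncard = (Finset.univ.filter (OnTwoCycle G)).card := by
    rw [← Set.ncard_coe_finset]; simp
  have hcard' : Fintype.card V - {v | OnTwoCycle G v}.ncard =
      (Finset.univ.filter fun v => ¬ OnTwoCycle G v).card := by
    rw [hcard, ← Finset.card_univ,
      ← Finset.card_filter_add_card_filter_not (s := Finset.univ) (OnTwoCycle G)]
    omega
  have hv : ∀ v ∈ M, vertexWeight G M v ≤ if OnTwoCycle G v then 37 / 25 else 323 / 250 := by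
    intro v hv
    split_ifs with h
    · unfold vertexWeight; split_ifs <;> norm_num
    · refine vertexWeight_le_of_partners (Finset.eq_empty_iff_forall_notMem.2 fun w hw => h ?_)
      rw [mem_partners] at hw
      refine ⟨w, ?_, hw.2⟩
      rintro rfl
      -- Looplessness matters: a loop would make `v` its own partner, and a loop is not a 2-cycle.
      exact mem_loopless.1 (hM hv) hw.2.1
  calc weight G M ≤ ∏ v ∈ M, if OnTwoCycle G v then (37 / 25 : ℝ) else 323 / 250 :=
        Finset.prod_le_prod (fun _ _ => zero_le_one.trans one_le_vertexWeight) hv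
    _ ≤ ∏ v, if OnTwoCycle G v then (37 / 25 : ℝ) else 323 / 250 :=
        Finset.prod_le_prod_of_subset_of_one_le (Finset.subset_univ _)
          (fun _ _ => by split_ifs <;> norm_num) (fun _ _ _ => by split_ifs <;> norm_num)
    _ = _ := by
        rw [Finset.prod_ite, Finset.prod_const, Finset.prod_const, hcard', hcard]

theorem ncard_onTwoCycle_le (G : Digraph V) :
    {v | OnTwoCycle G v}.ncard ≤ Fintype.card V := by
  rw [← Nat.card_eq_fintype_card]
  exact Set.ncard_le_card _

/-- The fraction times the number of vertices is the integer count, also for the empty digraph,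
where the fraction is 0/0 = 0. -/
theorem rpow_twoCycleFraction (G : Digraph V) {a b : ℝ} (ha : 0 < a) (hb : 0 < b) :
    (a ^ twoCycleFraction G * b ^ (1 - twoCycleFraction G)) ^ (Fintype.card V : ℝ) =
      a ^ {v | OnTwoCycle G v}.ncard *
        b ^ (Fintype.card V - {v | OnTwoCycle G v}.ncard) := by
  have hle := ncard_onTwoCycle_le G
  have h1 : twoCycleFraction G * Fintype.card V = ({v | OnTwoCycle G v}.ncard : ℕ) := by
    unfold twoCycleFraction
    rcases Nat.eq_zero_or_pos (Fintype.card V) with h | h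
    · rw [h] at hle ⊢
      simp [Nat.le_zero.1 hle]
    · exact div_mul_cancel₀ _ (by positivity)
  have h2 : (1 - twoCycleFraction G) * Fintype.card V =
      ((Fintype.card V - {v | OnTwoCycle G v}.ncard : ℕ) : ℝ) := by
    rw [Nat.cast_sub hle, ← h1]; ring
  rw [Real.mul_rpow (Real.rpow_nonneg ha.le _) (Real.rpow_nonneg hb.le _), ← Real.rpow_mul ha.le,
    ← Real.rpow_mul hb.le, h1, h2, Real.rpow_natCast, Real.rpow_natCast]

theorem weight_le_rpow {G : Digraph V} {M : Finset V} (hM : M ⊆ loopless G) {a b : ℝ}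
    (ha : 37 / 25 ≤ a) (hb : 323 / 250 ≤ b) : weight G M ≤
      (a ^ twoCycleFraction G * b ^ (1 - twoCycleFraction G)) ^ (Fintype.card V : ℝ) := by
  rw [rpow_twoCycleFraction G (by linarith) (by linarith)]
  refine (weight_le hM).trans ?_
  gcongr

theorem one_div_sqrt_two_le : 1 / √2 ≤ (7072 / 10000 : ℝ) := by
  have h : (14141 / 10000 : ℝ) ≤ √2 := Real.le_sqrt_of_sq_le (by norm_num)
  calc 1 / √2 ≤ 1 / (14141 / 10000 : ℝ) := one_div_le_one_div_of_le (by norm_num) h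
    _ ≤ _ := by norm_num

theorem le_two_rpow_quarter : (1189 / 1000 : ℝ) ≤ 2 ^ (1 / 4 : ℝ) := by
  have h : ((1189 / 1000 : ℝ) ^ (4 : ℕ)) ^ (1 / 4 : ℝ) ≤ 2 ^ (1 / 4 : ℝ) :=
    Real.rpow_le_rpow (by norm_num) (by norm_num) (by norm_num)
  rwa [← Real.rpow_natCast, ← Real.rpow_mul (by norm_num), show ((4 : ℕ) : ℝ) * (1 / 4) = 1 by
    norm_num, Real.rpow_one] at h

theorem weight_le_mlsBase {G : Digraph V} {M : Finset V} (hM : M ⊆ loopless G) :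
    weight G M ≤ mlsBase (twoCycleFraction G) ^ (Fintype.card V : ℝ) := by
  have h1 := one_div_sqrt_two_le
  have h2 := le_two_rpow_quarter
  exact weight_le_rpow hM (by linarith) (by linarith)

theorem weight_le_mlsBaseRounded {G : Digraph V} {M : Finset V} (hM : M ⊆ loopless G) :
    weight G M ≤ mlsBaseRounded (twoCycleFraction G) ^ (Fintype.card V : ℝ) :=
  weight_le_rpow hM (by norm_num) (by norm_num)

theorem Preferred.subset_loopless {G : Digraph V} {S : Finset V} (hS : Preferred G S) :
    S ⊆ loopless G := fun _ hv => mem_loopless.2 (hS.1.not_adj_self hv)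

variable [DecidableEq V]

/-- A stack of pairs `(M, I)`, each standing for the sets between `I` and `M`, and a list of
sets found so far. -/
abbrev SearchState (V : Type*) := List (Finset V × Finset V) × List (Finset V)

/-- One step of the search: take the topmost pair off the stack and either discard it, output
a set, or branch on the pivot. -/
noncomputable def searchStep (G : Digraph V) (piv : Finset V → Option V) :
    SearchState V → SearchState V
  | ([], o) => ([], o)
  | ((M, I) :: σ, o) =>
    if I ⊆ prune G M then
      match piv (prune G M) with
      | none => (σ, prune G M :: o)
      | some v => ((prune G M \ nbrs G (prune G M) v, insert v I) ::
          ((prune G M).erase v, I) :: σ, o)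
    else (σ, o)

/-- Induction on |M|. The set `I` separates the outputs of the two branches, since only the first
can contain `v`; hence no repetitions. Both children are strictly smaller than `M`, so their steps
total at most |M| times the potential of the parent, and the step spent here is covered by one more
copy. Quantifying over `σ` and `o` lets the two runs be composed on one stack. -/
theorem search_correct {G : Digraph V} {piv : Finset V → Option V} (hpiv : SelectsPivot G piv)
    (M I : Finset V) (hl : ∀ v ∈ M, ¬ G.Adj v v) :
    ∃ (L : List (Finset V)) (k : ℕ), L.Nodup ∧
      (∀ S ∈ L, Admissible G S ∧ I ⊆ S ∧ S ⊆ M) ∧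
      (∀ S, Preferred G S → I ⊆ S → S ⊆ M → S ∈ L) ∧
      (L.length : ℝ) ≤ potential G (prune G M) ∧
      (k : ℝ) ≤ (M.card + 1) * potential G (prune G M) ∧
      ∀ σ o, (searchStep G piv)^[k] ((M, I) :: σ, o) = (σ, L ++ o) := by
  induction hm : M.card using Nat.strong_induction_on generalizing M I with
  | _ m ih =>
  subst hm
  have hNM := prune_subset G M
  have hdef := defended_prune G M
  have hpot := one_le_potential (G := G) (N := prune G M)
  have hstep : (1 : ℝ) ≤ (M.card + 1) * potential G (prune G M) :=
    one_le_mul_of_one_le_of_one_le (by have := Nat.cast_nonneg (α := ℝ) M.card; linarith) hpot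
  by_cases hI : I ⊆ prune G M
  · rcases hp : piv (prune G M) with _ | v
    · have hno := (hpiv (prune G M)).2 hp
      have hadm : Admissible G (prune G M) := by
        refine ⟨fun u hu v hv h => hno 6 u ⟨hu, Finset.card_pos.2 ⟨v, ?_⟩⟩, hdef⟩
        exact mem_nbrs.2 ⟨hv, Or.inl h⟩
      refine ⟨[prune G M], 1, List.nodup_singleton _, ?_, ?_, by simpa using hpot,
        by simpa using hstep, fun σ o => ?_⟩
      · simpa using ⟨hadm, hI, hNM⟩
      · intro S hS _ hSM
        have := hS.1.subset_prune hSM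
        -- A preferred set below the admissible pruned set must equal it by maximality.
        exact List.mem_singleton.2 (this.antisymm (hS.2 hadm this))
      · simp [searchStep, hI, hp]
    · have hv := (hpiv (prune G M)).1 v hp
      obtain ⟨hvN, w, hw⟩ := hv.mem_and_nonempty
      have hlN : ∀ v ∈ prune G M, ¬ G.Adj v v := fun v h => hl v (hNM h)
      have hs1 : prune G M \ nbrs G (prune G M) v ⊆ prune G M := Finset.sdiff_subset
      have hs2 : (prune G M).erase v ⊆ prune G M := Finset.erase_subset _ _
      have hc1 : (prune G M \ nbrs G (prune G M) v).card < M.card :=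
        (Finset.card_lt_card (hs1.ssubset_of_ne fun e => (Finset.mem_sdiff.1
          (e.symm ▸ (mem_nbrs.1 hw).1 : w ∈ _ \ _)).2 hw)).trans_le (Finset.card_le_card hNM)
      have hc2 : ((prune G M).erase v).card < M.card :=
        (Finset.card_erase_lt_of_mem hvN).trans_le (Finset.card_le_card hNM)
      obtain ⟨L₁, k₁, nd₁, sound₁, compl₁, len₁, time₁, run₁⟩ :=
        ih _ hc1 _ (insert v I) (fun u hu => hlN u (hs1 hu)) rfl
      obtain ⟨L₂, k₂, nd₂, sound₂, compl₂, len₂, time₂, run₂⟩ :=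
        ih _ hc2 _ I (fun u hu => hlN u (hs2 hu)) rfl
      have hadd := hv.potential_add_le hlN hdef (prune_subset G _) (prune_subset G _)
        (defended_prune G ((prune G M).erase v))
      -- The branch with `v` runs first, but outputs are pushed onto the front, so its list comes
      -- last; iterates apply the right summand first.
      refine ⟨L₂ ++ L₁, k₂ + (k₁ + 1), ?_, ?_, ?_, ?_, ?_, fun σ o => ?_⟩
      · refine List.nodup_append.2 ⟨nd₂, nd₁, ?_⟩
        rintro S h₂ T h₁ rfl
        exact Finset.notMem_erase v _ ((sound₂ S h₂).2.2
          ((sound₁ S h₁).2.1 (Finset.mem_insert_self _ _)))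
      · intro S hS
        rcases List.mem_append.1 hS with h | h
        · obtain ⟨h1, h2, h3⟩ := sound₂ S h
          exact ⟨h1, h2, h3.trans (hs2.trans hNM)⟩
        · obtain ⟨h1, h2, h3⟩ := sound₁ S h
          exact ⟨h1, (Finset.subset_insert _ _).trans h2, h3.trans (hs1.trans hNM)⟩
      · intro S hS hIS hSM
        have hSN := hS.1.subset_prune hSM
        by_cases hvS : v ∈ S
        · refine List.mem_append_right _ (compl₁ S hS (Finset.insert_subset hvS hIS) ?_)
          refine fun u hu => Finset.mem_sdiff.2 ⟨hSN hu, fun hun => ?_⟩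
          rcases (mem_nbrs.1 hun).2 with h | h
          · exact hS.1.1 v hvS u hu h
          · exact hS.1.1 u hu v hvS h
        · refine List.mem_append_left _ (compl₂ S hS hIS fun u hu =>
            Finset.mem_erase.2 ⟨?_, hSN hu⟩)
          rintro rfl
          exact hvS hu
      · rw [List.length_append]
        push_cast
        linarith
      · have e1 : ((prune G M \ nbrs G (prune G M) v).card : ℝ) + 1 ≤ M.card := by
          exact_mod_cast hc1
        have e2 : (((prune G M).erase v).card : ℝ) + 1 ≤ M.card := by
          exact_mod_cast hc2
        have q1 := one_le_potential (G := G) (N := prune G (prune G M \ nbrs G (prune G M) v))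
        have q2 := one_le_potential (G := G) (N := prune G ((prune G M).erase v))
        have t1 := time₁.trans (mul_le_mul_of_nonneg_right e1 (zero_le_one.trans q1))
        have t2 := time₂.trans (mul_le_mul_of_nonneg_right e2 (zero_le_one.trans q2))
        have t3 := mul_le_mul_of_nonneg_left hadd (Nat.cast_nonneg (α := ℝ) M.card)
        push_cast
        linarith
      · rw [Function.iterate_add_apply, Function.iterate_succ_apply]
        have : searchStep G piv ((M, I) :: σ, o) =
            ((prune G M \ nbrs G (prune G M) v, insert v I) ::
              ((prune G M).erase v, I) :: σ, o) := by
          simp [searchStep, hI, hp]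
        rw [this, run₁, run₂, List.append_assoc]
  · refine ⟨[], 1, List.nodup_nil, by simp, ?_, by simpa using zero_le_one.trans hpot,
      by simpa using hstep, fun σ o => ?_⟩
    · exact fun S hS hIS hSM => absurd (hIS.trans (hS.1.subset_prune hSM)) hI
    · simp [searchStep, hI]

/-- The search also serves as a counting argument: its list contains every preferred extension, so
its length bounds their number. -/
theorem ncard_preferred_le (G : Digraph V) :
    ({S : Finset V | Preferred G S}.ncard : ℝ) ≤
      43 / 40 * weight G (prune G (loopless G)) := by
  obtain ⟨piv, hpiv⟩ := exists_selectsPivot G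
  obtain ⟨L, k, -, -, hL, hlen, -⟩ :=
    search_correct hpiv (loopless G) ∅ fun _ => mem_loopless.1
  refine le_trans ?_ (hlen.trans potential_le)
  have hsub : {S : Finset V | Preferred G S} ⊆ (L.toFinset : Set (Finset V)) := fun S hS =>
    List.mem_toFinset.2 (hL S hS (Finset.empty_subset _) (Preferred.subset_loopless hS))
  have := Set.ncard_le_ncard hsub (Finset.finite_toSet _)
  rw [Set.ncard_coe_finset] at this
  exact_mod_cast this.trans (List.toFinset_card_le L)

end Search
end AF

/-! ### A calculus of uniform polynomial-time programs -/

namespace TreeMachine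

open Data

/-- Some program takes `a i` to `b i` for all `i`, in time polynomial in `n i`. -/
def PolyRuns {ι : Type*} (n : ι → ℕ) (a b : ι → Data) : Prop :=
  ∃ (P : Prog) (p : Polynomial ℕ), ∀ i, ∃ t, Runs P (a i) (b i) t ∧ t ≤ p.eval (n i)

/-- Some program decides `φ i` given `a i`, in time polynomial in `n i`. -/
abbrev PolyDec {ι : Type*} (n : ι → ℕ) (a : ι → Data) (φ : ι → Prop) : Prop :=
  PolyRuns n a fun i => encodeProp (φ i)

theorem encodeProp_of_true {p : Prop} (h : p) : encodeProp p = .node .nil .nil := by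
  simp [encodeProp, h]

theorem encodeProp_of_false {p : Prop} (h : ¬ p) : encodeProp p = .nil := by
  simp [encodeProp, h]

namespace PolyRuns

variable {ι κ : Type*} {n : ι → ℕ} {a b c d : ι → Data}

theorem reindex (h : PolyRuns n a b) (g : κ → ι) :
    PolyRuns (fun k => n (g k)) (fun k => a (g k)) (fun k => b (g k)) :=
  let ⟨P, p, hP⟩ := h
  ⟨P, p, fun k => hP (g k)⟩

theorem nil : PolyRuns n a fun _ => .nil :=
  ⟨.nil, 1, fun i => ⟨1, .nil _, by simp⟩⟩

theorem id : PolyRuns n a a :=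
  ⟨.skip, 1, fun i => ⟨1, .skip _, by simp⟩⟩

theorem comp (h : PolyRuns n a b) (h' : PolyRuns n b c) : PolyRuns n a c := by
  obtain ⟨P, p, hP⟩ := h
  obtain ⟨Q, q, hQ⟩ := h'
  refine ⟨.seq P Q, p + q + 1, fun i => ?_⟩
  obtain ⟨s, hs, hs'⟩ := hP i
  obtain ⟨t, ht, ht'⟩ := hQ i
  exact ⟨_, .seq hs ht, by simp only [Polynomial.eval_add, Polynomial.eval_one]; omega⟩

theorem pair (h : PolyRuns n a b) (h' : PolyRuns n a c) :
    PolyRuns n a fun i => .node (b i) (c i) := by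
  obtain ⟨P, p, hP⟩ := h
  obtain ⟨Q, q, hQ⟩ := h'
  refine ⟨.pair P Q, p + q + 1, fun i => ?_⟩
  obtain ⟨s, hs, hs'⟩ := hP i
  obtain ⟨t, ht, ht'⟩ := hQ i
  exact ⟨_, .pair hs ht, by simp only [Polynomial.eval_add, Polynomial.eval_one]; omega⟩

theorem left : PolyRuns n (fun i => .node (b i) (c i)) b :=
  ⟨.left, 1, fun i => ⟨1, .left_node _ _, by simp⟩⟩

theorem right : PolyRuns n (fun i => .node (b i) (c i)) c :=
  ⟨.right, 1, fun i => ⟨1, .right_node _ _, by simp⟩⟩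

theorem fst (h : PolyRuns n a fun i => .node (b i) (c i)) : PolyRuns n a b := h.comp left

theorem snd (h : PolyRuns n a fun i => .node (b i) (c i)) : PolyRuns n a c := h.comp right

theorem tail {l : ι → List Data} (h : PolyRuns n a fun i => encodeList (l i)) :
    PolyRuns n a fun i => encodeList (l i).tail := by
  refine h.comp ⟨.right, 1, fun i => ⟨1, ?_, by simp⟩⟩
  dsimp only
  cases l i with
  | nil => exact .right_nil
  | cons x l => exact .right_node _ _

/-- Each branch need be correct only on the inputs that reach it, hence the subtypes as index types.
-/
theorem dite {p : ι → Prop} [∀ i, Decidable (p i)] (hd : PolyRuns n a d)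
    (hp : ∀ i, p i ↔ d i ≠ .nil)
    (h : PolyRuns (ι := {i // p i}) (fun i => n i) (fun i => a i) (fun i => b i))
    (h' : PolyRuns (ι := {i // ¬ p i}) (fun i => n i) (fun i => a i) (fun i => c i)) :
    PolyRuns n a fun i => if p i then b i else c i := by
  obtain ⟨O, o, hO⟩ := hd
  obtain ⟨P, p, hP⟩ := h
  obtain ⟨Q, q, hQ⟩ := h'
  refine ⟨.ite O P Q, o + p + q + 1, fun i => ?_⟩
  obtain ⟨s, hs, hs'⟩ := hO i
  simp only [Polynomial.eval_add, Polynomial.eval_one]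
  split_ifs with hi
  · obtain ⟨t, ht, ht'⟩ := hP ⟨i, hi⟩
    have hne := (hp i).1 hi
    cases hdi : d i with
    | nil => exact absurd hdi hne
    | node x y => exact ⟨_, .ite_true (hdi ▸ hs) ht, by dsimp only at ht'; omega⟩
  · obtain ⟨t, ht, ht'⟩ := hQ ⟨i, hi⟩
    have hdi : d i = .nil := by by_contra hne; exact hi ((hp i).2 hne)
    exact ⟨_, .ite_false (hdi ▸ hs) ht, by dsimp only at ht'; omega⟩

theorem ite {p : ι → Prop} [∀ i, Decidable (p i)] (hp : PolyDec n a p) (h : PolyRuns n a b)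
    (h' : PolyRuns n a c) : PolyRuns n a fun i => if p i then b i else c i := by
  refine dite hp (fun i => ?_) (h.reindex _) (h'.reindex _)
  by_cases hi : p i
  · rw [encodeProp_of_true hi]; simpa using hi
  · rw [encodeProp_of_false hi]; simpa using hi

/-- Weakening: a further item on the input is ignored. -/
theorem shift (h : PolyRuns n a b) (g : κ → ι) {x : κ → Data} :
    PolyRuns (fun k => n (g k)) (fun k => .node (x k) (a (g k))) (fun k => b (g k)) :=
  right.comp (h.reindex g)

/-- The loop state is the remaining list, the accumulator and the environment `a`. Indexing the body
by all items and all accumulators makes one polynomial in `n` bound every round, however large the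
accumulator grows. -/
theorem foldl {β γ : ι → Type*} (eβ : ∀ i, β i → Data) (eγ : ∀ i, γ i → Data)
    {l : ∀ i, List (β i)} {z : ∀ i, γ i} (f : ∀ i, γ i → β i → γ i) (q : Polynomial ℕ)
    (hq : ∀ i, (l i).length ≤ q.eval (n i))
    (hl : PolyRuns n a fun i => encodeList ((l i).map (eβ i)))
    (hz : PolyRuns n a fun i => eγ i (z i))
    (hf : PolyRuns (ι := Σ i, β i × γ i) (fun j => n j.1)
      (fun j => .node (eβ j.1 j.2.1) (.node (eγ j.1 j.2.2) (a j.1)))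
      (fun j => eγ j.1 (f j.1 j.2.2 j.2.1))) :
    PolyRuns n a fun i => eγ i ((l i).foldl (f i) (z i)) := by
  obtain ⟨L, pL, hL⟩ := hl
  obtain ⟨Z, pZ, hZ⟩ := hz
  obtain ⟨B, pB, hB⟩ := hf
  let body : Prog := .pair (.seq .left .right)
    (.pair (.seq (.pair (.seq .left .left) .right) B) (.seq .right .right))
  have loop : ∀ i (l : List (β i)) (z : γ i), ∃ t,
      Runs (.loop .left body)
        (.node (encodeList (l.map (eβ i))) (.node (eγ i z) (a i)))
        (.node .nil (.node (eγ i (l.foldl (f i) z)) (a i))) t ∧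
      -- Besides running `B`, each round costs exactly 16 steps for the test and for rearranging
      -- pointers.
      t ≤ l.length * (pB.eval (n i) + 16) + 2 := by
    intro i l
    induction l with
    | nil => exact fun z => ⟨_, .loop_done (.left_node _ _), by simp⟩
    | cons x l ih =>
      intro z
      obtain ⟨t, ht, ht'⟩ := ih (f i z x)
      obtain ⟨s, hs, hs'⟩ := hB ⟨i, x, z⟩
      refine ⟨_, .loop_step (.left_node _ _)
        (.pair (.seq (.left_node _ _) (.right_node _ _))
          (.pair (.seq (.pair (.seq (.left_node _ _) (.left_node _ _)) (.right_node _ _)) hs)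
            (.seq (.right_node _ _) (.right_node _ _)))) ht, ?_⟩
      dsimp only at hs'
      rw [List.length_cons, Nat.succ_mul]
      omega
  refine ⟨.seq (.pair L (.pair Z .skip)) (.seq (.loop .left body) (.seq .right .left)),
    pL + pZ + q * (pB + 16) + 13, fun i => ?_⟩
  obtain ⟨s, hs, hs'⟩ := hL i
  obtain ⟨t, ht, ht'⟩ := hZ i
  obtain ⟨u, hu, hu'⟩ := loop i (l i) (z i)
  refine ⟨_, .seq (.pair hs (.pair ht (.skip _)))
    (.seq hu (.seq (.right_node _ _) (.left_node _ _))), ?_⟩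
  have h := Nat.mul_le_mul_right (pB.eval (n i) + 16) (hq i)
  have e : (pL + pZ + q * (pB + 16) + 13).eval (n i) =
      pL.eval (n i) + pZ.eval (n i) + q.eval (n i) * (pB.eval (n i) + 16) + 13 := by
    simp [Polynomial.eval_add, Polynomial.eval_mul]
  rw [e]
  omega

/-- A fold over a unary counter whose items are ignored. -/
theorem iterate {γ : ι → Type*} (eγ : ∀ i, γ i → Data) {k : ι → ℕ} {z : ∀ i, γ i}
    (f : ∀ i, γ i → γ i) (q : Polynomial ℕ) (hq : ∀ i, k i ≤ q.eval (n i))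
    (hk : PolyRuns n a fun i => encodeList (List.replicate (k i) .nil))
    (hz : PolyRuns n a fun i => eγ i (z i))
    (hf : PolyRuns (ι := Σ i, γ i) (fun j => n j.1)
      (fun j => .node (eγ j.1 j.2) (a j.1)) (fun j => eγ j.1 (f j.1 j.2))) :
    PolyRuns n a fun i => eγ i ((f i)^[k i] (z i)) := by
  have h := foldl (β := fun _ => Unit) (fun _ _ => .nil) eγ (l := fun i => List.replicate (k i) ())
    (fun i x _ => f i x) q (by simpa using hq) (by simpa using hk) hz
    (right.comp (hf.reindex fun j : Σ i, Unit × γ i => ⟨j.1, j.2.2⟩))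
  simpa [List.foldl_const] using h

end PolyRuns

namespace PolyDec

variable {ι : Type*} {n : ι → ℕ} {a d : ι → Data} {φ ψ : ι → Prop}

theorem congr (h : PolyDec n a φ) (hφ : ∀ i, φ i ↔ ψ i) : PolyDec n a ψ := by
  rwa [show ψ = φ from funext fun i => propext (hφ i).symm]

theorem const (p : Prop) : PolyDec n a fun _ => p := by
  by_cases h : p
  · simpa only [PolyDec, encodeProp_of_true h] using PolyRuns.nil.pair PolyRuns.nil
  · simpa only [PolyDec, encodeProp_of_false h] using PolyRuns.nil

theorem of_ne_nil (h : PolyRuns n a d) : PolyDec n a fun i => d i ≠ .nil := by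
  classical
  have := h.dite (b := fun _ => .node .nil .nil) (c := fun _ => .nil) (fun i => Iff.rfl)
    (PolyRuns.nil.pair PolyRuns.nil) PolyRuns.nil
  unfold PolyDec
  convert this using 2 with i
  by_cases hi : d i = .nil <;> simp [encodeProp, hi]

theorem not (h : PolyDec n a φ) : PolyDec n a fun i => ¬ φ i := by
  classical
  have := PolyRuns.ite h PolyRuns.nil (PolyRuns.nil.pair PolyRuns.nil)
  unfold PolyDec
  convert this using 2 with i
  by_cases hi : φ i <;> simp [encodeProp, hi]

theorem and (h : PolyDec n a φ) (h' : PolyDec n a ψ) : PolyDec n a fun i => φ i ∧ ψ i := by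
  classical
  have := PolyRuns.ite h h' PolyRuns.nil
  unfold PolyDec
  convert this using 2 with i
  by_cases hi : φ i <;> simp [encodeProp, hi]

theorem or (h : PolyDec n a φ) (h' : PolyDec n a ψ) : PolyDec n a fun i => φ i ∨ ψ i :=
  (h.not.and h'.not).not.congr fun i => by tauto

theorem imp (h : PolyDec n a φ) (h' : PolyDec n a ψ) : PolyDec n a fun i => φ i → ψ i :=
  (h.and h'.not).not.congr fun i => by tauto

end PolyDec

/-- A natural number in unary. -/
def encodeNat (k : ℕ) : Data := encodeList (List.replicate k .nil)

/-- All vertices, in decreasing order. -/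
def encodeVertices (n : ℕ) : Data :=
  encodeList ((List.finRange n).reverse.map fun v : Fin n => encodeNat v)

theorem encodeNat_ne_nil {k : ℕ} : encodeNat k ≠ .nil ↔ 0 < k := by
  cases k <;> simp [encodeNat, encodeList, List.replicate_succ]

namespace PolyRuns

variable {ι κ : Type*} {n : ι → ℕ} {a b : ι → Data}

theorem drop {l : ι → List Data} (hl : PolyRuns n a fun i => encodeList (l i)) {k : ι → ℕ}
    (hk : PolyRuns n a fun i => encodeNat (k i)) (hkn : ∀ i, k i ≤ n i) :
    PolyRuns n a fun i => encodeList ((l i).drop (k i)) := by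
  have h := iterate (γ := fun _ => List Data) (fun _ => encodeList) (fun _ => List.tail)
    Polynomial.X (by simpa using hkn) hk hl (tail left)
  simpa [List.tail_iterate] using h

theorem lookup {f : ∀ i, Fin (n i) → Data}
    (h : PolyRuns n a fun i => encodeList ((List.finRange (n i)).map (f i)))
    {v : ∀ i, Fin (n i)} (hv : PolyRuns n a fun i => encodeNat (v i)) :
    PolyRuns n a fun i => f i (v i) := by
  have h' := h.drop hv fun i => (v i).2.le
  simp only [← List.map_drop] at h'
  have e : ∀ i, (List.finRange (n i)).drop (v i) =
      v i :: (List.finRange (n i)).drop (v i + 1) := by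
    intro i
    rw [List.drop_eq_getElem_cons (by simp)]
    simp
  simp only [e, List.map_cons, encodeList] at h'
  exact h'.fst

theorem foldlVertices {γ : ι → Type*} (eγ : ∀ i, γ i → Data) {z : ∀ i, γ i}
    (f : ∀ i, γ i → Fin (n i) → γ i) (hV : PolyRuns n a fun i => encodeVertices (n i))
    (hz : PolyRuns n a fun i => eγ i (z i))
    (hf : PolyRuns (ι := Σ i, Fin (n i) × γ i) (fun j => n j.1)
      (fun j => .node (encodeNat j.2.1) (.node (eγ j.1 j.2.2) (a j.1)))
      (fun j => eγ j.1 (f j.1 j.2.2 j.2.1))) :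
    PolyRuns n a fun i => eγ i ((List.finRange (n i)).reverse.foldl (f i) (z i)) :=
  foldl (fun i (v : Fin (n i)) => encodeNat v) eγ f Polynomial.X (by simp) hV hz hf

/-- Ignoring the accumulator in the body of a fold. -/
theorem dropSecond {γ : ι → Type*} {eγ : ∀ i, γ i → Data} {b : (Σ i, Fin (n i)) → Data}
    (h : PolyRuns (ι := Σ i, Fin (n i)) (fun j => n j.1)
      (fun j => .node (encodeNat j.2) (a j.1)) b) :
    PolyRuns (ι := Σ i, Fin (n i) × γ i) (fun j => n j.1)
      (fun j => .node (encodeNat j.2.1) (.node (eγ j.1 j.2.2) (a j.1)))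
      (fun j => b ⟨j.1, j.2.1⟩) :=
  (pair left right.snd).comp (h.reindex fun j : Σ i, Fin (n i) × γ i => ⟨j.1, j.2.1⟩)

/-- Consing during a left fold reverses the order; this is why the vertices are stored in decreasing
order. Set operations thereby reduce to deciding membership. -/
theorem encodeSet_of_mem {S : ∀ i, Finset (Fin (n i))}
    (hV : PolyRuns n a fun i => encodeVertices (n i))
    (h : PolyDec (ι := Σ i, Fin (n i)) (fun j => n j.1)
      (fun j => .node (encodeNat j.2) (a j.1)) (fun j => j.2 ∈ S j.1)) :
    PolyRuns n a fun i => encodeSet (S i) := by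
  have h' := foldlVertices (γ := fun _ => List Data) (fun _ => encodeList) (z := fun _ => [])
    (fun i l v => encodeProp (v ∈ S i) :: l) hV nil
    (pair (dropSecond (eγ := fun _ => encodeList) h) right.fst)
  simp only [List.foldl_reverse] at h'
  simpa [encodeSet] using h'

theorem card {S : ∀ i, Finset (Fin (n i))} (hV : PolyRuns n a fun i => encodeVertices (n i))
    (h : PolyDec (ι := Σ i, Fin (n i)) (fun j => n j.1)
      (fun j => .node (encodeNat j.2) (a j.1)) (fun j => j.2 ∈ S j.1)) :
    PolyRuns n a fun i => encodeNat (S i).card := by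
  have h' := foldlVertices (γ := fun _ => ℕ) (fun _ => encodeNat) (z := fun _ => 0)
    (fun i k v => if v ∈ S i then k + 1 else k) hV nil (by
      have := ite (dropSecond (eγ := fun _ => encodeNat) h) (nil.pair right.fst) right.fst
      convert this using 2 with j
      split_ifs <;> rfl)
  convert h' using 3 with i
  have key : ∀ (l : List (Fin (n i))) (k : ℕ),
      l.foldl (fun k v => if v ∈ S i then k + 1 else k) k = k + (l.filter (· ∈ S i)).length := by
    intro l
    induction l with
    | nil => simp
    | cons x l ih =>
      intro k
      by_cases hx : x ∈ S i <;> simp [hx, ih]; omega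
  rw [key, zero_add, ← List.toFinset_card_of_nodup
    ((List.nodup_reverse.2 (List.nodup_finRange _)).filter _)]
  congr 1
  ext v
  simp

theorem option_elim {o : ∀ i, Option (Fin (n i))} {f : ∀ i, Fin (n i) → Data}
    (ho : PolyRuns n a fun i => (o i).elim .nil fun v => .node (encodeNat v) .nil)
    (hb : PolyRuns n a b)
    (hf : PolyRuns (ι := Σ i, Fin (n i)) (fun j => n j.1)
      (fun j => .node (encodeNat j.2) (a j.1)) (fun j => f j.1 j.2)) :
    PolyRuns n a fun i => (o i).elim (b i) (f i) := by
  have h1 : PolyRuns (ι := {i // (o i).isSome}) (fun i => n i) (fun i => a i)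
      (fun i => f i ((o i).get i.2)) := by
    refine comp (pair (fst (c := fun _ => .nil) ?_) id)
      (hf.reindex fun i : {i // (o i).isSome} => ⟨i, (o i).get i.2⟩)
    convert ho.reindex (Subtype.val : {i // (o i).isSome} → ι) using 2 with i
    obtain ⟨i, hi⟩ := i
    obtain ⟨v, hv⟩ := Option.isSome_iff_exists.1 hi
    simp [hv]
  have := dite (b := fun i => (o i).elim .nil (f i)) (c := b) ho (p := fun i => (o i).isSome)
    (fun i => by cases o i <;> simp) (by
      convert h1 using 2 with i
      obtain ⟨i, hi⟩ := i
      obtain ⟨v, hv⟩ := Option.isSome_iff_exists.1 hi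
      simp [hv]) (hb.reindex _)
  convert this using 2 with i
  cases o i <;> simp

end PolyRuns

namespace PolyDec

variable {ι : Type*} {n : ι → ℕ} {a : ι → Data}

theorem exists_vertex {φ : ∀ i, Fin (n i) → Prop}
    (hV : PolyRuns n a fun i => encodeVertices (n i))
    (h : PolyDec (ι := Σ i, Fin (n i)) (fun j => n j.1)
      (fun j => .node (encodeNat j.2) (a j.1)) (fun j => φ j.1 j.2)) :
    PolyDec n a fun i => ∃ v, φ i v := by
  have h' := PolyRuns.foldlVertices (γ := fun _ => Prop) (fun _ => encodeProp)
    (z := fun _ => False) (fun i p v => p ∨ φ i v) hV (const False)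
    (or PolyRuns.right.fst (PolyRuns.dropSecond (eγ := fun _ => encodeProp) h))
  refine congr h' fun i => ?_
  have key : ∀ (l : List (Fin (n i))) (p : Prop),
      l.foldl (fun p v => p ∨ φ i v) p ↔ p ∨ ∃ v ∈ l, φ i v := by
    intro l
    induction l with
    | nil => simp
    | cons x l ih => intro p; simp [ih, or_assoc]
  rw [key]
  simp

theorem forall_vertex {φ : ∀ i, Fin (n i) → Prop}
    (hV : PolyRuns n a fun i => encodeVertices (n i))
    (h : PolyDec (ι := Σ i, Fin (n i)) (fun j => n j.1)
      (fun j => .node (encodeNat j.2) (a j.1)) (fun j => φ j.1 j.2)) :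
    PolyDec n a fun i => ∀ v, φ i v :=
  (exists_vertex (φ := fun i v => ¬ φ i v) hV h.not).not.congr fun i => by simp

theorem mem {S : ∀ i, Finset (Fin (n i))} (hS : PolyRuns n a fun i => encodeSet (S i))
    {v : ∀ i, Fin (n i)} (hv : PolyRuns n a fun i => encodeNat (v i)) :
    PolyDec n a fun i => v i ∈ S i :=
  PolyRuns.lookup (f := fun i v => encodeProp (v ∈ S i)) hS hv

theorem adj {G : ∀ i, Digraph (Fin (n i))} (hG : PolyRuns n a fun i => encodeDigraph (G i))
    {u v : ∀ i, Fin (n i)} (hu : PolyRuns n a fun i => encodeNat (u i))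
    (hv : PolyRuns n a fun i => encodeNat (v i)) :
    PolyDec n a fun i => (G i).Adj (u i) (v i) :=
  PolyRuns.lookup (f := fun i v => encodeProp ((G i).Adj (u i) v))
    (PolyRuns.lookup (f := fun i u => encodeList ((List.finRange (n i)).map
      fun v => encodeProp ((G i).Adj u v))) hG hu) hv

/-- Dropping `k` items from the unary `m` leaves something exactly when `k < m`. The bound on `k`
keeps the loop polynomial. -/
theorem lt {k m : ι → ℕ} (hk : PolyRuns n a fun i => encodeNat (k i)) (hkn : ∀ i, k i ≤ n i)
    (hm : PolyRuns n a fun i => encodeNat (m i)) : PolyDec n a fun i => k i < m i := by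
  have := of_ne_nil (PolyRuns.drop hm hk hkn)
  simp only [List.drop_replicate] at this
  exact this.congr fun i => encodeNat_ne_nil.trans (by omega)

theorem eq {u v : ∀ i, Fin (n i)} (hu : PolyRuns n a fun i => encodeNat (u i))
    (hv : PolyRuns n a fun i => encodeNat (v i)) : PolyDec n a fun i => u i = v i :=
  ((lt hu (fun i => (u i).2.le) hv).not.and (lt hv (fun i => (v i).2.le) hu).not).congr
    fun i => by rw [Fin.ext_iff]; omega

theorem le_const {m : ι → ℕ} (hm : PolyRuns n a fun i => encodeNat (m i)) (k : ℕ) :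
    PolyDec n a fun i => k + 1 ≤ m i := by
  have h : PolyRuns n a fun i => encodeNat (m i - k) := by
    induction k with
    | zero => exact hm
    | succ k ih =>
      have := ih.tail
      simpa [encodeNat, Nat.sub_sub] using this
  exact (of_ne_nil h).congr fun i => encodeNat_ne_nil.trans (by omega)

end PolyDec

end TreeMachine

/-! ### Programs for the graph and set operations -/

namespace TreeMachine

open AF

/-- The adjacency matrix and the list of vertices are available on the input. -/
structure GraphInput {ι : Type*} (n : ι → ℕ) (a : ι → Data) (G : ∀ i, Digraph (Fin (n i))) :
    Prop where
  adj : PolyRuns n a fun i => encodeDigraph (G i)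
  verts : PolyRuns n a fun i => encodeVertices (n i)

section Sets

variable {ι κ : Type*} {n : ι → ℕ} {a : ι → Data} {G : ∀ i, Digraph (Fin (n i))}
  {M I : ∀ i, Finset (Fin (n i))} {v : ∀ i, Fin (n i)}

theorem GraphInput.shift (hg : GraphInput n a G) (g : κ → ι) {x : κ → Data} :
    GraphInput (fun k => n (g k)) (fun k => .node (x k) (a (g k))) (fun k => G (g k)) :=
  ⟨hg.adj.shift g, hg.verts.shift g⟩

theorem PolyRuns.pruneStep (hg : GraphInput n a G) (hM : PolyRuns n a fun i => encodeSet (M i)) :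
    PolyRuns n a fun i => encodeSet (pruneStep (G i) (M i)) := by
  refine encodeSet_of_mem hg.verts (PolyDec.congr (φ := fun j : (Σ i, Fin (n i)) => j.2 ∈ M j.1 ∧
    ∀ u, (G j.1).Adj u j.2 → ∃ w, w ∈ M j.1 ∧ (G j.1).Adj w u) ?_
    fun j => mem_pruneStep.symm)
  have hM1 := hM.shift (Sigma.fst : (Σ i, Fin (n i)) → ι) (x := fun j => encodeNat j.2)
  have hg1 := hg.shift (Sigma.fst : (Σ i, Fin (n i)) → ι) (x := fun j => encodeNat j.2)
  refine PolyDec.and (PolyDec.mem hM1 left) (PolyDec.forall_vertex hg1.verts ?_)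
  have hg2 := hg1.shift (Sigma.fst : (Σ j : (Σ i, Fin (n i)), Fin (n j.1)) → _)
    (x := fun j => encodeNat j.2)
  have hM2 := hM1.shift (Sigma.fst : (Σ j : (Σ i, Fin (n i)), Fin (n j.1)) → _)
    (x := fun j => encodeNat j.2)
  refine PolyDec.imp (PolyDec.adj hg2.adj left right.fst)
    (PolyDec.exists_vertex hg2.verts ?_)
  exact PolyDec.and (PolyDec.mem (hM2.shift Sigma.fst) left)
    (PolyDec.adj (hg2.shift Sigma.fst).adj left right.fst)

theorem PolyRuns.vertexCount (hg : GraphInput n a G) :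
    PolyRuns n a fun i => encodeNat (n i) := by
  have h := card (S := fun i => (Finset.univ : Finset (Fin (n i)))) hg.verts
    ((PolyDec.const True).congr fun j => by simp)
  simpa using h

theorem PolyRuns.prune (hg : GraphInput n a G) (hM : PolyRuns n a fun i => encodeSet (M i)) :
    PolyRuns n a fun i => encodeSet (prune (G i) (M i)) := by
  have h := iterate (γ := fun i => Finset (Fin (n i))) (fun _ => encodeSet)
    (fun i => AF.pruneStep (G i)) Polynomial.X (by simp) (vertexCount hg) hM
    (pruneStep (hg.shift Sigma.fst) left)
  simpa [AF.prune] using h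

theorem PolyRuns.nbrs (hg : GraphInput n a G) (hM : PolyRuns n a fun i => encodeSet (M i))
    (hv : PolyRuns n a fun i => encodeNat (v i)) :
    PolyRuns n a fun i => encodeSet (nbrs (G i) (M i) (v i)) := by
  refine encodeSet_of_mem hg.verts (PolyDec.congr (φ := fun j => j.2 ∈ M j.1 ∧
    ((G j.1).Adj (v j.1) j.2 ∨ (G j.1).Adj j.2 (v j.1))) ?_ fun j => mem_nbrs.symm)
  have hg1 := hg.shift (Sigma.fst : (Σ i, Fin (n i)) → ι) (x := fun j => encodeNat j.2)
  exact PolyDec.and (PolyDec.mem (hM.shift Sigma.fst) left)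
    (PolyDec.or (PolyDec.adj hg1.adj (hv.shift Sigma.fst) left)
      (PolyDec.adj hg1.adj left (hv.shift Sigma.fst)))

theorem PolyRuns.partners (hg : GraphInput n a G) (hM : PolyRuns n a fun i => encodeSet (M i))
    (hv : PolyRuns n a fun i => encodeNat (v i)) :
    PolyRuns n a fun i => encodeSet (partners (G i) (M i) (v i)) := by
  refine encodeSet_of_mem hg.verts (PolyDec.congr (φ := fun j => j.2 ∈ M j.1 ∧
    ((G j.1).Adj (v j.1) j.2 ∧ (G j.1).Adj j.2 (v j.1))) ?_ fun j => mem_partners.symm)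
  have hg1 := hg.shift (Sigma.fst : (Σ i, Fin (n i)) → ι) (x := fun j => encodeNat j.2)
  exact PolyDec.and (PolyDec.mem (hM.shift Sigma.fst) left)
    (PolyDec.and (PolyDec.adj hg1.adj (hv.shift Sigma.fst) left)
      (PolyDec.adj hg1.adj left (hv.shift Sigma.fst)))

theorem PolyRuns.attackers (hg : GraphInput n a G) (hM : PolyRuns n a fun i => encodeSet (M i))
    (hv : PolyRuns n a fun i => encodeNat (v i)) :
    PolyRuns n a fun i => encodeSet (attackers (G i) (M i) (v i)) := by
  refine encodeSet_of_mem hg.verts (PolyDec.congr (φ := fun j => j.2 ∈ M j.1 ∧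
    (G j.1).Adj j.2 (v j.1)) ?_ fun j => mem_attackers.symm)
  exact PolyDec.and (PolyDec.mem (hM.shift Sigma.fst) left)
    (PolyDec.adj (hg.shift Sigma.fst).adj left (hv.shift Sigma.fst))

theorem PolyRuns.targets (hg : GraphInput n a G) (hM : PolyRuns n a fun i => encodeSet (M i))
    (hv : PolyRuns n a fun i => encodeNat (v i)) :
    PolyRuns n a fun i => encodeSet (targets (G i) (M i) (v i)) := by
  refine encodeSet_of_mem hg.verts (PolyDec.congr (φ := fun j => j.2 ∈ M j.1 ∧
    (G j.1).Adj (v j.1) j.2) ?_ fun j => mem_targets.symm)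
  exact PolyDec.and (PolyDec.mem (hM.shift Sigma.fst) left)
    (PolyDec.adj (hg.shift Sigma.fst).adj (hv.shift Sigma.fst) left)

theorem PolyDec.lt_card (hV : PolyRuns n a fun i => encodeVertices (n i))
    (hM : PolyRuns n a fun i => encodeSet (M i)) (k : ℕ) :
    PolyDec n a fun i => k + 1 ≤ (M i).card :=
  le_const (PolyRuns.card hV (mem (hM.shift Sigma.fst) PolyRuns.left)) k

theorem PolyDec.subset (hV : PolyRuns n a fun i => encodeVertices (n i))
    (hI : PolyRuns n a fun i => encodeSet (I i)) (hM : PolyRuns n a fun i => encodeSet (M i)) :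
    PolyDec n a fun i => I i ⊆ M i :=
  forall_vertex (φ := fun i v => v ∈ I i → v ∈ M i) hV
    (imp (mem (hI.shift Sigma.fst) PolyRuns.left) (mem (hM.shift Sigma.fst) PolyRuns.left))

theorem PolyRuns.sdiff (hV : PolyRuns n a fun i => encodeVertices (n i))
    (hM : PolyRuns n a fun i => encodeSet (M i)) (hI : PolyRuns n a fun i => encodeSet (I i)) :
    PolyRuns n a fun i => encodeSet (M i \ I i) :=
  encodeSet_of_mem hV (PolyDec.congr (φ := fun j => j.2 ∈ M j.1 ∧ ¬ j.2 ∈ I j.1)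
    (PolyDec.and (PolyDec.mem (hM.shift Sigma.fst) left)
      (PolyDec.not (PolyDec.mem (hI.shift Sigma.fst) left))) fun _ => Finset.mem_sdiff.symm)

theorem PolyRuns.erase (hV : PolyRuns n a fun i => encodeVertices (n i))
    (hM : PolyRuns n a fun i => encodeSet (M i)) (hv : PolyRuns n a fun i => encodeNat (v i)) :
    PolyRuns n a fun i => encodeSet ((M i).erase (v i)) :=
  encodeSet_of_mem hV (PolyDec.congr (φ := fun j => ¬ j.2 = v j.1 ∧ j.2 ∈ M j.1)
    (PolyDec.and (PolyDec.not (PolyDec.eq left (hv.shift Sigma.fst)))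
      (PolyDec.mem (hM.shift Sigma.fst) left)) fun _ => Finset.mem_erase.symm)

theorem PolyRuns.insert (hV : PolyRuns n a fun i => encodeVertices (n i))
    (hM : PolyRuns n a fun i => encodeSet (M i)) (hv : PolyRuns n a fun i => encodeNat (v i)) :
    PolyRuns n a fun i => encodeSet (insert (v i) (M i)) :=
  encodeSet_of_mem hV (PolyDec.congr (φ := fun j => j.2 = v j.1 ∨ j.2 ∈ M j.1)
    (PolyDec.or (PolyDec.eq left (hv.shift Sigma.fst))
      (PolyDec.mem (hM.shift Sigma.fst) left)) fun _ => Finset.mem_insert.symm)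

theorem PolyRuns.loopless (hg : GraphInput n a G) :
    PolyRuns n a fun i => encodeSet (loopless (G i)) :=
  encodeSet_of_mem hg.verts (PolyDec.congr (φ := fun j => ¬ (G j.1).Adj j.2 j.2)
    (PolyDec.not (PolyDec.adj (hg.shift Sigma.fst).adj left left)) fun _ => mem_loopless.symm)

theorem PolyRuns.emptySet (hV : PolyRuns n a fun i => encodeVertices (n i)) :
    PolyRuns n a fun i => encodeSet (∅ : Finset (Fin (n i))) :=
  encodeSet_of_mem hV ((PolyDec.const False).congr fun j => by simp)

/-- The vertices are produced by counting the rows of the adjacency matrix. -/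
theorem GraphInput.of_adj (h : PolyRuns n a fun i => encodeDigraph (G i)) :
    GraphInput n a G := by
  refine ⟨h, ?_⟩
  -- The accumulator `k` is encoded as a pair: `k` in unary and the list of `k - 1, …, 0`. Each
  -- matrix row pushes `k` onto the list and increments it.
  have h' := PolyRuns.foldl (γ := fun _ => ℕ)
    (fun i u => encodeList ((List.finRange (n i)).map fun v => encodeProp ((G i).Adj u v)))
    (fun _ k => .node (encodeNat k) (encodeList ((List.range k).reverse.map encodeNat)))
    (l := fun i => List.finRange (n i)) (z := fun _ => 0)
    (fun _ k _ => k + 1) Polynomial.X (by simp) h (PolyRuns.nil.pair PolyRuns.nil) (by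
      have h1 : PolyRuns (ι := Σ i, Fin (n i) × ℕ) (fun j => n j.1)
        (fun j => .node (encodeList ((List.finRange (n j.1)).map fun v =>
          encodeProp ((G j.1).Adj j.2.1 v))) (.node (.node (encodeNat j.2.2)
            (encodeList ((List.range j.2.2).reverse.map encodeNat))) (a j.1)))
        (fun j => .node (encodeNat j.2.2)
            (encodeList ((List.range j.2.2).reverse.map encodeNat))) := PolyRuns.right.fst
      have h2 := PolyRuns.pair (PolyRuns.pair PolyRuns.nil h1.fst) (PolyRuns.pair h1.fst h1.snd)
      convert h2 using 2 with j
      simp [List.range_succ, encodeNat, List.replicate_succ, encodeList])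
  have e : ∀ (m k : ℕ) (l : List (Fin m)), l.foldl (fun k _ => k + 1) k = k + l.length := by
    intro m k l
    induction l generalizing k with
    | nil => rfl
    | cons x l ih => simp [ih]; omega
  simp only [e, List.length_finRange, zero_add] at h'
  convert h'.snd using 2 with i
  rw [encodeVertices, List.map_reverse, List.map_reverse, ← List.map_coe_finRange_eq_range,
    List.map_map]
  rfl

end Sets

/-! ### Computing the pivot -/

section Pivot

variable {ι : Type*} {n : ι → ℕ} {a : ι → Data} {G : ∀ i, Digraph (Fin (n i))}
  {M : ∀ i, Finset (Fin (n i))}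

theorem PolyDec.pivotRule (hg : GraphInput n a G) (hM : PolyRuns n a fun i => encodeSet (M i))
    (k : ℕ) : PolyDec (ι := Σ i, Fin (n i)) (fun j => n j.1)
      (fun j => .node (encodeNat j.2) (a j.1)) (fun j => PivotRule (G j.1) (M j.1) k j.2) := by
  have hg1 := hg.shift (Sigma.fst : (Σ i, Fin (n i)) → ι) (x := fun j => encodeNat j.2)
  have hM1 := hM.shift (Sigma.fst : (Σ i, Fin (n i)) → ι) (x := fun j => encodeNat j.2)
  have hg2 := hg1.shift (Sigma.fst : (Σ j : (Σ i, Fin (n i)), Fin (n j.1)) → _)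
    (x := fun j => encodeNat j.2)
  have hM2 := hM1.shift (Sigma.fst : (Σ j : (Σ i, Fin (n i)), Fin (n j.1)) → _)
    (x := fun j => encodeNat j.2)
  have hmem : PolyDec (ι := Σ i, Fin (n i)) (fun j => n j.1)
    (fun j => .node (encodeNat j.2) (a j.1)) (fun j => j.2 ∈ M j.1) := mem hM1 PolyRuns.left
  have hpart := fun k => lt_card hg1.verts (PolyRuns.partners hg1 hM1 PolyRuns.left) k
  have hnbrs := fun k => lt_card hg1.verts (PolyRuns.nbrs hg1 hM1 PolyRuns.left) k
  have hatt := (lt_card hg2.verts (PolyRuns.attackers hg2 hM2 PolyRuns.left) 1).not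
  have htar := lt_card hg2.verts (PolyRuns.targets hg2 hM2 PolyRuns.left) 0
  have hmem2 := mem hM2 PolyRuns.left
  have hadj2 := adj (u := fun j : (Σ j : (Σ i, Fin (n i)), Fin (n j.1)) => j.1.2) hg2.adj
    PolyRuns.right.fst PolyRuns.left
  match k with
  | 0 => exact hmem.and ((hpart 0).and ((hnbrs 2).or (hpart 1)))
  | 1 => exact hmem.and ((hpart 0).and (hnbrs 1))
  | 2 => exact hmem.and (hpart 0)
  | 3 => exact hmem.and (exists_vertex hg1.verts (hmem2.and (hadj2.and (hatt.and htar))))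
  | 4 => exact hmem.and (exists_vertex hg1.verts (hmem2.and (hadj2.and hatt)))
  | 5 => exact hmem.and (hnbrs 4)
  | 6 => exact hmem.and (hnbrs 0)
  | k + 7 => exact const False

open Classical in
/-- The first vertex that satisfies `φ`, or `d` if there is none. -/
noncomputable def findVertex {m : ℕ} (φ : Fin m → Prop) (d : Option (Fin m)) :
    Option (Fin m) :=
  (List.finRange m).reverse.foldl (fun o v => if φ v then some v else o) d

theorem findVertex_cases {m : ℕ} (φ : Fin m → Prop) (d : Option (Fin m)) :
    (∃ v, φ v ∧ findVertex φ d = some v) ∨ ((∀ v, ¬ φ v) ∧ findVertex φ d = d) := by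
  classical
  have key : ∀ l : List (Fin m), (∃ v, φ v ∧
      l.foldr (fun v o => if φ v then some v else o) d = some v) ∨
      ((∀ v ∈ l, ¬ φ v) ∧ l.foldr (fun v o => if φ v then some v else o) d = d) := by
    intro l
    induction l with
    | nil => simp
    | cons x l ih =>
      by_cases hx : φ x
      · exact Or.inl ⟨x, hx, by simp [hx]⟩
      · simpa [hx] using ih
  have := key (List.finRange m)
  simp only [List.mem_finRange, true_imp_iff] at this
  unfold findVertex
  rw [List.foldl_reverse]
  convert this

/-- A possibly absent vertex as a tree. -/
def encodeOption {m : ℕ} (o : Option (Fin m)) : Data :=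
  o.elim .nil fun v => .node (encodeNat v) .nil

theorem PolyRuns.findVertex {φ : ∀ i, Fin (n i) → Prop} {d : ∀ i, Option (Fin (n i))}
    (hV : PolyRuns n a fun i => encodeVertices (n i))
    (hφ : PolyDec (ι := Σ i, Fin (n i)) (fun j => n j.1)
      (fun j => .node (encodeNat j.2) (a j.1)) (fun j => φ j.1 j.2))
    (hd : PolyRuns n a fun i => encodeOption (d i)) :
    PolyRuns n a fun i => encodeOption (findVertex (φ i) (d i)) := by
  classical
  have := foldlVertices (γ := fun i => Option (Fin (n i))) (fun _ => encodeOption) (z := d)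
    (fun i o v => if φ i v then some v else o) hV hd (by
      have h := ite (dropSecond (eγ := fun i => encodeOption (m := n i)) hφ)
        (left.pair nil) right.fst
      convert h using 2 with j
      split_ifs <;> rfl)
  unfold TreeMachine.findVertex
  convert this

/-- The pivot chosen by the program. -/
noncomputable def firstPivot {m : ℕ} (G : Digraph (Fin m)) (M : Finset (Fin m)) :
    Option (Fin m) :=
  (List.range 7).foldr (fun k d => findVertex (PivotRule G M k) d) none

theorem PolyRuns.firstPivot (hg : GraphInput n a G)
    (hM : PolyRuns n a fun i => encodeSet (M i)) :
    PolyRuns n a fun i => encodeOption (firstPivot (G i) (M i)) := by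
  unfold TreeMachine.firstPivot
  induction List.range 7 with
  | nil => exact nil
  | cons k l ih => exact findVertex hg.verts (PolyDec.pivotRule hg hM k) ih

/-- Each rule falls back on the next one as its default, so a found vertex comes with the failure of
all earlier rules. Seven rules suffice because the later ones are empty. -/
theorem selectsPivot_firstPivot {m : ℕ} (G : Digraph (Fin m)) :
    SelectsPivot G (firstPivot G) := by
  intro M
  have key : ∀ l k, (∀ j < k, ∀ v, ¬ PivotRule G M j v) →
      (∃ v, IsPivot G M v ∧ (List.range' k l).foldr
        (fun k d => findVertex (PivotRule G M k) d) none = some v) ∨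
      ((∀ j < k + l, ∀ v, ¬ PivotRule G M j v) ∧ (List.range' k l).foldr
        (fun k d => findVertex (PivotRule G M k) d) none = none) := by
    intro l
    induction l with
    | zero => exact fun k hk => Or.inr ⟨hk, rfl⟩
    | succ l ih =>
      intro k hk
      rw [List.range'_succ, List.foldr_cons]
      rcases findVertex_cases (PivotRule G M k) ((List.range' (k + 1) l).foldr
        (fun k d => findVertex (PivotRule G M k) d) none) with ⟨v, hv, e⟩ | ⟨hv, e⟩
      · exact Or.inl ⟨v, ⟨k, hv, hk⟩, e⟩
      · rw [e, show k + (l + 1) = k + 1 + l by ring]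
        refine ih (k + 1) fun j hj => ?_
        rcases Nat.lt_succ_iff_lt_or_eq.1 hj with h | rfl
        · exact hk j h
        · exact hv
  unfold firstPivot
  rw [List.range_eq_range']
  rcases key 7 0 (by simp) with ⟨v, hv, e⟩ | ⟨hv, e⟩
  · rw [e]
    exact ⟨fun w hw => Option.some.inj hw ▸ hv, by simp⟩
  · rw [e]
    refine ⟨by simp, fun _ k v hk => ?_⟩
    by_cases h : k < 7
    · exact hv k (by omega) v hk
    · obtain ⟨k, rfl⟩ : ∃ j, k = j + 7 := ⟨k - 7, by omega⟩
      exact hk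

end Pivot

end TreeMachine

/-! ### One search step and the main loop -/

namespace TreeMachine

open AF

/-- A pair of sets as a tree. -/
noncomputable def encodePair {m : ℕ} (x : Finset (Fin m) × Finset (Fin m)) : Data :=
  .node (encodeSet x.1) (encodeSet x.2)

/-- A state of the search, together with the adjacency matrix and the list of vertices. -/
noncomputable def encodeState {m : ℕ} (G : Digraph (Fin m)) (s : SearchState (Fin m)) : Data :=
  .node (encodeList (s.1.map encodePair))
    (.node (encodeSets s.2) (.node (encodeDigraph G) (encodeVertices m)))

section Step

variable {ι : Type*} {n : ι → ℕ} {a : ι → Data} {G : ∀ i, Digraph (Fin (n i))}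
  {M N I : ∀ i, Finset (Fin (n i))} {v : ∀ i, Fin (n i)}
  {σ : ∀ i, List (Finset (Fin (n i)) × Finset (Fin (n i)))} {o : ∀ i, List (Finset (Fin (n i)))}

theorem PolyRuns.encodeState (hg : GraphInput n a G)
    (hσ : PolyRuns n a fun i => encodeList ((σ i).map encodePair))
    (ho : PolyRuns n a fun i => encodeSets (o i)) :
    PolyRuns n a fun i => encodeState (G i) (σ i, o i) :=
  hσ.pair (ho.pair (hg.adj.pair hg.verts))

theorem PolyRuns.branch (hg : GraphInput n a G) (hN : PolyRuns n a fun i => encodeSet (N i))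
    (hI : PolyRuns n a fun i => encodeSet (I i)) (hv : PolyRuns n a fun i => encodeNat (v i))
    (hσ : PolyRuns n a fun i => encodeList ((σ i).map encodePair))
    (ho : PolyRuns n a fun i => encodeSets (o i)) :
    PolyRuns n a fun i => TreeMachine.encodeState (G i)
      ((N i \ AF.nbrs (G i) (N i) (v i), Insert.insert (v i) (I i)) ::
        ((N i).erase (v i), I i) :: σ i, o i) :=
  encodeState hg (((sdiff hg.verts hN (nbrs hg hN hv)).pair (insert hg.verts hI hv)).pair
    (((erase hg.verts hN hv).pair hI).pair hσ)) ho

theorem PolyRuns.searchStep (hg : GraphInput n a G) (hM : PolyRuns n a fun i => encodeSet (M i))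
    (hI : PolyRuns n a fun i => encodeSet (I i))
    (hσ : PolyRuns n a fun i => encodeList ((σ i).map encodePair))
    (ho : PolyRuns n a fun i => encodeSets (o i)) :
    PolyRuns n a fun i => TreeMachine.encodeState (G i)
      (searchStep (G i) (TreeMachine.firstPivot (G i)) ((M i, I i) :: σ i, o i)) := by
  have hN := prune hg hM
  have hN' := hN.shift (Sigma.fst : (Σ i, Fin (n i)) → ι) (x := fun j => encodeNat j.2)
  have hleaf := encodeState hg hσ (o := fun i => AF.prune (G i) (M i) :: o i) (hN.pair ho)
  have hb := branch (v := fun j : (Σ i, Fin (n i)) => j.2) (hg.shift Sigma.fst) hN'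
    (hI.shift Sigma.fst) left (hσ.shift Sigma.fst) (ho.shift Sigma.fst)
  have h := ite (PolyDec.subset hg.verts hI hN) (option_elim (f := fun i v =>
    TreeMachine.encodeState (G i) ((AF.prune (G i) (M i) \ AF.nbrs (G i) (AF.prune (G i) (M i)) v,
      Insert.insert v (I i)) :: ((AF.prune (G i) (M i)).erase v, I i) :: σ i, o i))
    (firstPivot hg hN) hleaf hb) (encodeState hg hσ ho)
  convert h using 2 with i
  by_cases hI : I i ⊆ AF.prune (G i) (M i)
  · cases hp : TreeMachine.firstPivot (G i) (AF.prune (G i) (M i)) <;>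
      simp [AF.searchStep, hI, hp]
  · simp [AF.searchStep, hI]

end Step

/-- The instances on which the body of the main loop is run. -/
abbrev StepInput := Σ m : ℕ, Digraph (Fin m) × (Finset (Fin m) × Finset (Fin m)) ×
  List (Finset (Fin m) × Finset (Fin m)) × List (Finset (Fin m))

/-- The size parameter is only the number of vertices: the rest of the stack and the outputs are
passed on as pointers, so their possibly exponential length costs nothing. -/
theorem polyRuns_searchStep : PolyRuns (fun i : StepInput => i.1)
    (fun i => encodeState i.2.1 (i.2.2.1 :: i.2.2.2.1, i.2.2.2.2))
    (fun i => encodeState i.2.1 (searchStep i.2.1 (firstPivot i.2.1)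
      (i.2.2.1 :: i.2.2.2.1, i.2.2.2.2))) := by
  have h : PolyRuns (fun i : StepInput => i.1)
      (fun i => encodeState i.2.1 (i.2.2.1 :: i.2.2.2.1, i.2.2.2.2))
      (fun i => .node (encodePair i.2.2.1) (encodeList (i.2.2.2.1.map encodePair))) :=
    PolyRuns.left
  have h' : PolyRuns (fun i : StepInput => i.1)
      (fun i => encodeState i.2.1 (i.2.2.1 :: i.2.2.2.1, i.2.2.2.2))
      (fun i => .node (encodeSets i.2.2.2.2) (.node (encodeDigraph i.2.1) (encodeVertices i.1))) :=
    PolyRuns.right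
  exact PolyRuns.searchStep (M := fun i : StepInput => i.2.2.1.1)
    (I := fun i : StepInput => i.2.2.1.2) ⟨h'.snd.fst, h'.snd.snd⟩ h.fst.fst h.fst.snd h.snd h'.fst

theorem polyRuns_start : PolyRuns (fun i : (Σ m : ℕ, Digraph (Fin m)) => i.1)
    (fun i => encodeDigraph i.2) (fun i => encodeState i.2 ([(loopless i.2, ∅)], [])) := by
  have hg : GraphInput (fun i : (Σ m : ℕ, Digraph (Fin m)) => i.1) (fun i => encodeDigraph i.2)
      (fun i => i.2) := .of_adj .id
  exact PolyRuns.encodeState (o := fun _ => []) hg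
    (((PolyRuns.loopless hg).pair (PolyRuns.emptySet hg.verts)).pair .nil) .nil

theorem exists_loop : ∃ (B : Prog) (p : Polynomial ℕ), ∀ (m : ℕ) (G : Digraph (Fin m)) (k : ℕ)
    (s : SearchState (Fin m)), ((searchStep G (firstPivot G))^[k] s).1 = [] →
    ∃ t, Runs (.loop .left B) (encodeState G s)
      (encodeState G ((searchStep G (firstPivot G))^[k] s)) t ∧ t ≤ k * p.eval m + 2 := by
  obtain ⟨B, p, hB⟩ := polyRuns_searchStep
  refine ⟨B, p + 2, fun m G k => ?_⟩
  have hnil : ∀ o, searchStep G (firstPivot G) ([], o) = ([], o) := fun o => rfl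
  induction k with
  | zero =>
    rintro ⟨σ, o⟩ (rfl : σ = [])
    exact ⟨_, .loop_done (.left_node _ _), by simp⟩
  | succ k ih =>
    rintro ⟨σ, o⟩ hs
    cases σ with
    | nil =>
      -- With an empty stack the machine stops, while `searchStep` idles; surplus iterations change
      -- nothing.
      rw [Function.iterate_fixed (hnil o)]
      exact ⟨_, .loop_done (.left_node _ _), by simp⟩
    | cons x σ =>
      rw [Function.iterate_succ_apply] at hs ⊢
      obtain ⟨t, ht, ht'⟩ := ih _ hs
      obtain ⟨u, hu, hu'⟩ := hB ⟨m, G, x, σ, o⟩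
      refine ⟨_, .loop_step (.left_node _ _) hu ht, ?_⟩
      simp only [Polynomial.eval_add, Polynomial.eval_ofNat] at ht' ⊢
      rw [Nat.succ_mul]
      dsimp only at hu'
      omega

theorem exists_enumeration : ∃ (P : Prog) (p : Polynomial ℕ), ∀ (n : ℕ) (G : Digraph (Fin n)),
    ∃ (L : List (Finset (Fin n))) (t : ℕ), Runs P (encodeDigraph G) (encodeSets L) t ∧
      L.Nodup ∧ (∀ S, Preferred G S → S ∈ L) ∧ (∀ S ∈ L, Admissible G S) ∧
      (t : ℝ) ≤ (p.eval n : ℕ) * weight G (prune G (loopless G)) := by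
  obtain ⟨A, p, hA⟩ := polyRuns_start
  obtain ⟨B, q, hB⟩ := exists_loop
  refine ⟨.seq A (.seq (.loop .left B) (.seq .right .left)), p + 2 * (Polynomial.X + 1) * q + 7,
    fun n G => ?_⟩
  obtain ⟨L, k, nodup, sound, compl, -, time, run⟩ :=
    search_correct (selectsPivot_firstPivot G) (loopless G) ∅ fun _ => mem_loopless.1
  have hrun := run [] []
  rw [List.append_nil] at hrun
  obtain ⟨s, hs, hs'⟩ := hA ⟨n, G⟩
  obtain ⟨t, ht, ht'⟩ := hB n G k ([(loopless G, ∅)], []) (by rw [hrun])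
  rw [hrun] at ht
  refine ⟨L, _, .seq hs (.seq ht (.seq (.right_node _ _) (.left_node _ _))), nodup,
    fun S hS => compl S hS (Finset.empty_subset _) (Preferred.subset_loopless hS),
    fun S hS => (sound S hS).1, ?_⟩
  have hw : 1 ≤ weight G (prune G (loopless G)) := one_le_weight
  -- The factor 2 generously absorbs the penalty 43/40 and keeps the polynomial over the natural
  -- numbers.
  have hk : (k : ℝ) ≤ 2 * (n + 1) * weight G (prune G (loopless G)) := by
    have h1 : ((loopless G).card : ℝ) ≤ n := by
      exact_mod_cast (Finset.card_le_univ _).trans_eq (Fintype.card_fin n)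
    have h2 := potential_le (G := G) (N := prune G (loopless G))
    have h3 := one_le_potential (G := G) (N := prune G (loopless G))
    calc (k : ℝ) ≤ (n + 1) * potential G (prune G (loopless G)) :=
          time.trans (mul_le_mul_of_nonneg_right (by linarith) (by linarith))
      _ ≤ (n + 1) * (2 * weight G (prune G (loopless G))) :=
          mul_le_mul_of_nonneg_left (by linarith) (by positivity)
      _ = _ := by ring
  have hs'' : (s : ℝ) ≤ (p.eval n : ℕ) := by exact_mod_cast hs'
  have ht'' : (t : ℝ) ≤ k * (q.eval n : ℕ) + 2 := by exact_mod_cast ht'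
  have hkq := mul_le_mul_of_nonneg_right hk (Nat.cast_nonneg (α := ℝ) (q.eval n))
  have hp : ((p.eval n : ℕ) : ℝ) ≤ (p.eval n : ℕ) * weight G (prune G (loopless G)) :=
    le_mul_of_one_le_right (Nat.cast_nonneg _) hw
  simp only [Polynomial.eval_add, Polynomial.eval_mul, Polynomial.eval_ofNat, Polynomial.eval_X,
    Polynomial.eval_one]
  push_cast
  linarith

end TreeMachine

/-! ### The theorem -/

theorem mainTheorem3 :
    -- a single program that, on every digraph, lists (without repetition) admissible sets among
    -- which are all preferred extensions, within the stated number of steps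
    (∃ (P : TreeMachine.Prog) (p : Polynomial ℝ) (f : ℕ → ℝ),
      Asymptotics.IsLittleO Filter.atTop f (fun n : ℕ => (n : ℝ)) ∧
      ∀ (n : ℕ) (G : Digraph (Fin n)), ∃ (L : List (Finset (Fin n))) (t : ℕ),
        TreeMachine.Runs P (TreeMachine.encodeDigraph G) (TreeMachine.encodeSets L) t ∧
        L.Nodup ∧
        (∀ S, AF.Preferred G S → S ∈ L) ∧
        (∀ S ∈ L, AF.Admissible G S) ∧
        (t : ℝ) ≤ p.eval (n : ℝ) * mlsBase (AF.twoCycleFraction G) ^ ((n : ℝ) + f n) ∧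
        (t : ℝ) ≤ p.eval (n : ℝ) * mlsBaseRounded (AF.twoCycleFraction G) ^ (n : ℝ)) ∧
    -- the number of preferred extensions
    (∃ p : Polynomial ℝ, ∀ (V : Type*) [Fintype V] (G : Digraph V),
      ({S : Finset V | AF.Preferred G S}.ncard : ℝ) ≤
          p.eval (Fintype.card V : ℝ) *
            mlsBase (AF.twoCycleFraction G) ^ (Fintype.card V : ℝ) ∧
      ({S : Finset V | AF.Preferred G S}.ncard : ℝ) ≤
          p.eval (Fintype.card V : ℝ) *
            mlsBaseRounded (AF.twoCycleFraction G) ^ (Fintype.card V : ℝ)) := by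
  have hmono : ∀ {x w c : ℝ} {q : ℝ}, x ≤ q * w → 0 ≤ q → w ≤ c → x ≤ q * c :=
    fun h hq hw => h.trans (mul_le_mul_of_nonneg_left hw hq)
  constructor
  · obtain ⟨P, p, hP⟩ := TreeMachine.exists_enumeration
    -- No o(n) correction is needed, because both weights lie below the exact bases.
    refine ⟨P, p.map (Nat.castRingHom ℝ), fun _ => 0, Asymptotics.isLittleO_zero _ _,
      fun n G => ?_⟩
    obtain ⟨L, t, hrun, hnodup, hcompl, hsound, htime⟩ := hP n G
    have hp : (p.map (Nat.castRingHom ℝ)).eval (n : ℝ) = (p.eval n : ℕ) := by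
      simp [Polynomial.eval_natCast_map]
    have hM := AF.prune_subset G (AF.loopless G)
    have h1 := AF.weight_le_mlsBase hM
    have h2 := AF.weight_le_mlsBaseRounded hM
    rw [Fintype.card_fin] at h1 h2
    refine ⟨L, t, hrun, hnodup, hcompl, hsound, ?_, ?_⟩
    · rw [hp, add_zero]
      exact hmono htime (Nat.cast_nonneg _) h1
    · rw [hp]
      exact hmono htime (Nat.cast_nonneg _) h2
  · refine ⟨Polynomial.C (43 / 40), fun V _ G => ?_⟩
    classical
    have hM := AF.prune_subset G (AF.loopless G)
    rw [Polynomial.eval_C]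
    exact ⟨hmono (AF.ncard_preferred_le G) (by norm_num) (AF.weight_le_mlsBase hM),
      hmono (AF.ncard_preferred_le G) (by norm_num) (AF.weight_le_mlsBaseRounded hM)⟩
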